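/- Let $\mathbb{D}=\{z\in\mathbb{C}:|z|<1\}$, let $D(\zeta,r)=\{z\in\mathbb{C}:|z-\zeta|<r\}$, and let $0<C<\infty$. For an analytic function $A$ in $\mathbb{D}$, a non-trivial solution means an analytic function $f\not\equiv 0$ in $\mathbb{D}$ with $f''+Af=0$ in $\mathbb{D}$. (i) Let $A$ be analytic in $\mathbb{D}$. If $$|A(z)|(1-|z|^2)^2\le 1+C(1-|z|),\qquad z\in\mathbb{D},$$ then every non-trivial solution of $f''+Af=0$ has at most one zero in each Euclidean disc $D(\zeta,(1+C)^{-1})$ with $|\zeta|\le C/(1+C)$. (ii) Conversely, there is a function $\Psi_C:\left(\frac{C}{1+C},1\right)\to(0,\infty)$, depending only on $C$, with $\Psi_C(r)\to(2C)^+$ as $r\to1^-$ (that is, $\Psi_C(r)\to 2C$ and $\Psi_C(r)>2C$ for all $r<1$ close enough to $1$), such that the following holds. If $A$ is analytic in $\mathbb{D}$ and every non-trivial solution of $f''+Af=0$ has at most one zero in each Euclidean disc $D(\zeta,(1+C)^{-1})$ with $|\zeta|\le C/(1+C)$, then $$|A(z)|(1-|z|^2)^2\le 3\bigl(1+\Psi_C(|z|)(1-|z|)\bigr),\qquad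 \frac{C}{1+C}<|z|<1.$$ -/

import Mathlib

open Filter Topology

/-- The open unit disc `𝔻` of the complex plane. -/
def unitDisc : Set ℂ := Metric.ball 0 1

/-- `f` is a non-trivial (analytic, not identically zero) solution in the unit disc of the
differential equation `f'' + A f = 0`. -/
structure IsNontrivialSolution (A f : ℂ → ℂ) : Prop where
  analytic : AnalyticOnNhd ℂ f unitDisc
  equation : ∀ z ∈ unitDisc, deriv (deriv f) z + A z * f z = 0
  nontrivial : ∃ z ∈ unitDisc, f z ≠ 0

/-- Every non-trivial solution of `f'' + A f = 0` has at most one zero in each Euclidean disc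
`D(ζ, 1/(1+C))` with `|ζ| ≤ C/(1+C)`.  (Such discs are contained in the unit disc.) -/
def AtMostOneZeroInDiscs (A : ℂ → ℂ) (C : ℝ) : Prop :=
  ∀ f : ℂ → ℂ, IsNontrivialSolution A f →
    ∀ ζ : ℂ, ‖ζ‖ ≤ C / (1 + C) →
      {z : ℂ | z ∈ Metric.ball ζ (1 + C)⁻¹ ∧ f z = 0}.Subsingleton

/-! Put `ρ = (1 + C)⁻¹`, so that `C / (1 + C) = 1 - ρ` and the discs `D(ζ, ρ)` in question lie in
the unit disc. Both directions transplant the equation from such a disc to the unit disc: a Möbius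
change of variable `M` turns the coefficient `A` into `(A ∘ M) * M' ^ 2` and keeps track of zeros
(`IsSolution.mobius`).

For (i), `M w = ρ w + ζ`. By `localization_inequality` the new coefficient `B` satisfies `|B w| (1 -
|w|²)² ≤ 1`, and Nehari's criterion (`IsSolution.eq_zero_of_nehari`) leaves room for only one zero.
That criterion follows by moving two zeros to `0` and `r` and applying a Sturm comparison on `[0,
r]` (`eq_zero_of_sturm`).

For (ii), given `z`, take the disc `D(ζ, ρ)` containing `z` that touches the unit circle at `z /
|z|`, and `M` from the unit disc onto it with `M 0 = z`. Pulled-back solutions have at most one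
zero, so the quotient `g₂ / g₁ = 1/w - (B 0 / 3) w + ⋯` of two normalised ones is injective. The
area theorem (`norm_le_one_of_injOn`) gives `|B 0| ≤ 3`, which is Kraus' theorem
(`norm_le_three_of_kraus`). Since `B 0 = A z * M' 0 ^ 2`, computing `M' 0` yields the bound on `A
z`. Solutions with prescribed initial data at `z` come from power series at the origin and one more
Möbius change of variable. -/

/-! ### Power series solutions at the origin. -/

/-- The power series with coefficients `a` converges absolutely in the unit disc. -/
def DiscSummable (a : ℕ → ℂ) : Prop :=
  ∀ s : ℝ, 0 ≤ s → s < 1 → Summable fun n => ‖a n‖ * s ^ n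

theorem isOpen_unitDisc : IsOpen unitDisc := Metric.isOpen_ball

theorem mem_unitDisc {z : ℂ} : z ∈ unitDisc ↔ ‖z‖ < 1 := by simp [unitDisc]

theorem zero_mem_unitDisc : (0 : ℂ) ∈ unitDisc := by simp [mem_unitDisc]

theorem isPreconnected_unitDisc : IsPreconnected unitDisc :=
  (convex_ball (0 : ℂ) 1).isPreconnected

theorem DiscSummable.derivative {a : ℕ → ℂ} (ha : DiscSummable a) :
    DiscSummable fun n => ((n : ℂ) + 1) * a (n + 1) := by
  intro s hs0 hs1
  obtain ⟨t, hst, ht1⟩ := exists_between hs1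
  have ht0 : 0 < t := lt_of_le_of_lt hs0 hst
  have hsum := ha t ht0.le ht1
  obtain ⟨M, hM⟩ := hsum.tendsto_atTop_zero.bddAbove_range
  have hq0 : 0 ≤ s / t := by positivity
  have hq1 : s / t < 1 := (div_lt_one ht0).2 hst
  have hg : Summable fun n : ℕ => ((n : ℝ) ^ 1 * (s / t) ^ n + (s / t) ^ n) * (M / t) :=
    ((summable_pow_mul_geometric_of_norm_lt_one (R := ℝ) 1
      (by rwa [Real.norm_of_nonneg hq0])).add
        (summable_geometric_of_lt_one hq0 hq1)).mul_right _
  refine Summable.of_nonneg_of_le (fun n => by positivity) (fun n => ?_) hg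
  have h1 : ‖a (n + 1)‖ * t ^ (n + 1) ≤ M := hM ⟨n + 1, rfl⟩
  have h2 : ‖((n : ℂ) + 1) * a (n + 1)‖ = ((n : ℝ) + 1) * ‖a (n + 1)‖ := by
    rw [norm_mul]; norm_cast
  rw [h2, div_pow]
  have h3 : ‖a (n + 1)‖ ≤ M / t ^ (n + 1) := by rwa [le_div_iff₀ (by positivity)]
  calc ((n : ℝ) + 1) * ‖a (n + 1)‖ * s ^ n
      ≤ ((n : ℝ) + 1) * (M / t ^ (n + 1)) * s ^ n := by gcongr
    _ = _ := by rw [pow_succ]; field_simp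

theorem DiscSummable.hasDerivAt {a : ℕ → ℂ} (ha : DiscSummable a) {z : ℂ} (hz : z ∈ unitDisc) :
    HasDerivAt (fun w => ∑' n, a n * w ^ n) (∑' n : ℕ, (((n : ℂ) + 1) * a (n + 1)) * z ^ n) z := by
  obtain ⟨s, hzs, hs1⟩ := exists_between (mem_unitDisc.1 hz)
  have hs0 : 0 ≤ s := (norm_nonneg z).trans hzs.le
  have hd : ∀ n : ℕ, DifferentiableOn ℂ (fun w : ℂ => a n * w ^ n) (Metric.ball 0 s) :=
    fun n => by fun_prop
  have hle : ∀ (n : ℕ) (w : ℂ), w ∈ Metric.ball (0 : ℂ) s → ‖a n * w ^ n‖ ≤ ‖a n‖ * s ^ n := by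
    intro n w hw
    rw [norm_mul, norm_pow]
    have : ‖w‖ ≤ s := by simpa using (mem_ball_zero_iff.1 hw).le
    gcongr
  have hz' : z ∈ Metric.ball (0 : ℂ) s := by simpa using hzs
  have h1 := Complex.differentiableOn_tsum_of_summable_norm (ha s hs0 hs1) hd Metric.isOpen_ball hle
  have h2 := Complex.hasSum_deriv_of_summable_norm (ha s hs0 hs1) hd Metric.isOpen_ball hle hz'
  have h3 := (h1.differentiableAt (Metric.isOpen_ball.mem_nhds hz')).hasDerivAt
  convert! h3 using 1
  rw [← h2.tsum_eq, h2.summable.tsum_eq_zero_add]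
  simp [mul_assoc, mul_comm, mul_left_comm]

theorem exists_discSummable {A : ℂ → ℂ} (hA : DifferentiableOn ℂ A unitDisc) :
    ∃ a : ℕ → ℂ, DiscSummable a ∧ ∀ z ∈ unitDisc, A z = ∑' n, a n * z ^ n := by
  have h : ∀ z ∈ unitDisc, HasSum (fun n : ℕ => ((n.factorial : ℂ)⁻¹ * iteratedDeriv n A 0) * z ^ n)
      (A z) := by
    intro z hz
    have := Complex.hasSum_taylorSeries_on_ball (f := A) (c := 0) (r := 1) hA hz
    simpa [mul_comm, mul_assoc, mul_left_comm] using this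
  refine ⟨_, fun s hs0 hs1 => ?_, fun z hz => (h z hz).tsum_eq.symm⟩
  have := (h (s : ℂ) (by simpa [mem_unitDisc, abs_of_nonneg hs0] using hs1)).summable.norm
  simpa [abs_of_nonneg hs0] using this

/-- The Taylor coefficients at the origin of the solution of `f'' + A f = 0` with `f 0 = α` and
`f' 0 = β`, where `a` is the sequence of Taylor coefficients of `A`. -/
noncomputable def odeCoeff (a : ℕ → ℂ) (α β : ℂ) : ℕ → ℂ
  | 0 => α
  | 1 => β
  | n + 2 => -(∑ k : Fin (n + 1), odeCoeff a α β k * a (n - k)) / (((n : ℂ) + 1) * ((n : ℂ) + 2))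

theorem odeCoeff_add_two (a : ℕ → ℂ) (α β : ℂ) (n : ℕ) :
    ((n : ℂ) + 1) * (((n : ℂ) + 2) * odeCoeff a α β (n + 2)) =
      -∑ p ∈ Finset.HasAntidiagonal.antidiagonal n, odeCoeff a α β p.1 * a p.2 := by
  have h1 : (n : ℂ) + 1 ≠ 0 := by exact_mod_cast n.succ_ne_zero
  have h2 : (n : ℂ) + 2 ≠ 0 := by exact_mod_cast (n + 1).succ_ne_zero
  rw [odeCoeff, Finset.Nat.sum_antidiagonal_eq_sum_range_succ_mk, Finset.sum_range]
  field_simp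

/-- Take `K` to be the maximum of the first terms. If all terms before index `m + 2` are at most
`K`, the convolution in the recursion is at most `K * S`, where `S = ∑ ‖a n‖ s ^ n`. The recursion
divides it by `(m + 1)(m + 2)`, which exceeds `S` once `m ≥ S`, so the bound `K` propagates. -/
theorem norm_odeCoeff_mul_pow_le {a : ℕ → ℂ} (ha : DiscSummable a) (α β : ℂ) {s : ℝ} (hs0 : 0 ≤ s)
    (hs1 : s < 1) : ∃ K, ∀ n, ‖odeCoeff a α β n‖ * s ^ n ≤ K := by
  set c := odeCoeff a α β
  set S := ∑' n, ‖a n‖ * s ^ n with hS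
  obtain ⟨N, hN⟩ := exists_nat_ge S
  obtain ⟨K, hK⟩ := ((Finset.range (N + 2)).image fun n => ‖c n‖ * s ^ n).bddAbove
  have hK' : ∀ n < N + 2, ‖c n‖ * s ^ n ≤ K := fun n hn =>
    hK (by simpa using ⟨n, hn, rfl⟩)
  refine ⟨K, fun n => ?_⟩
  have hK0 : 0 ≤ K := le_trans (by positivity) (hK' 0 (by omega))
  induction n using Nat.strong_induction_on with
  | _ n ih =>
    by_cases hn : n < N + 2
    · exact hK' n hn
    obtain ⟨m, rfl⟩ : ∃ m, n = m + 2 := ⟨n - 2, by omega⟩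
    have hm : S ≤ (m : ℝ) := hN.trans (by exact_mod_cast (by omega : N ≤ m))
    have h1 := congrArg norm (odeCoeff_add_two a α β m)
    have e1 : ‖(m : ℂ) + 1‖ = (m : ℝ) + 1 := by norm_cast
    have e2 : ‖(m : ℂ) + 2‖ = (m : ℝ) + 2 := by norm_cast
    rw [norm_mul, norm_mul, norm_neg, e1, e2] at h1
    have h2 : (‖∑ p ∈ Finset.HasAntidiagonal.antidiagonal m, c p.1 * a p.2‖) * s ^ m ≤ K * S := by
      calc (‖∑ p ∈ Finset.HasAntidiagonal.antidiagonal m, c p.1 * a p.2‖) * s ^ m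
          ≤ (∑ p ∈ Finset.HasAntidiagonal.antidiagonal m, ‖c p.1 * a p.2‖) * s ^ m := by
            gcongr; exact norm_sum_le _ _
        _ = ∑ p ∈ Finset.HasAntidiagonal.antidiagonal m, (‖c p.1‖ * s ^ p.1) * (‖a p.2‖ * s ^ p.2) := by
            rw [Finset.sum_mul]
            refine Finset.sum_congr rfl fun p hp => ?_
            rw [← Finset.HasAntidiagonal.mem_antidiagonal.1 hp, norm_mul, pow_add]; ring
        _ ≤ ∑ p ∈ Finset.HasAntidiagonal.antidiagonal m, K * (‖a p.2‖ * s ^ p.2) := by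
            refine Finset.sum_le_sum fun p hp => ?_
            have := Finset.HasAntidiagonal.mem_antidiagonal.1 hp
            gcongr
            exact ih _ (by omega)
        _ = K * ∑ k ∈ Finset.range (m + 1), ‖a k‖ * s ^ k := by
            rw [← Finset.mul_sum, ← Finset.Nat.sum_antidiagonal_swap,
              Finset.Nat.sum_antidiagonal_eq_sum_range_succ_mk]
            rfl
        _ ≤ K * S := by
            gcongr
            exact (ha s hs0 hs1).sum_le_tsum _ fun i _ => by positivity
    have hS0 : 0 ≤ S := tsum_nonneg fun n => by positivity
    have h3 : (((m : ℝ) + 1) * (m + 2)) * (‖c (m + 2)‖ * s ^ m) ≤ K * S := by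
      calc (((m : ℝ) + 1) * (m + 2)) * (‖c (m + 2)‖ * s ^ m)
          = (((m : ℝ) + 1) * ((m + 2) * ‖c (m + 2)‖)) * s ^ m := by ring
        _ ≤ K * S := by rw [h1]; exact h2
    have h4 : S ≤ ((m : ℝ) + 1) * (m + 2) := by nlinarith
    have h5 : ‖c (m + 2)‖ * s ^ m ≤ K := by
      have hpos : 0 < ((m : ℝ) + 1) * (m + 2) := by positivity
      refine le_of_mul_le_mul_left (h3.trans ?_) hpos
      nlinarith
    calc ‖c (m + 2)‖ * s ^ (m + 2) = (‖c (m + 2)‖ * s ^ m) * s ^ 2 := by ring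
      _ ≤ K * 1 := by
          gcongr
          exact pow_le_one₀ hs0 hs1.le
      _ = K := mul_one K

theorem discSummable_odeCoeff {a : ℕ → ℂ} (ha : DiscSummable a) (α β : ℂ) :
    DiscSummable (odeCoeff a α β) := by
  intro s hs0 hs1
  obtain ⟨t, hst, ht1⟩ := exists_between hs1
  have ht0 : 0 < t := lt_of_le_of_lt hs0 hst
  obtain ⟨K, hK⟩ := norm_odeCoeff_mul_pow_le ha α β ht0.le ht1
  refine Summable.of_nonneg_of_le (fun n => by positivity) (fun n => ?_)
    ((summable_geometric_of_lt_one (by positivity) ((div_lt_one ht0).2 hst)).mul_left K)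
  have := hK n
  rw [← le_div_iff₀ (by positivity)] at this
  calc _ ≤ K / t ^ n * s ^ n := by gcongr
    _ = _ := by rw [div_pow]; ring

theorem exists_solution_at_zero {A : ℂ → ℂ} (hA : DifferentiableOn ℂ A unitDisc) (α β : ℂ) :
    ∃ f : ℂ → ℂ, DifferentiableOn ℂ f unitDisc ∧
      (∀ z ∈ unitDisc, deriv (deriv f) z + A z * f z = 0) ∧ f 0 = α ∧ deriv f 0 = β := by
  obtain ⟨a, ha, hAa⟩ := exists_discSummable hA
  have hc := discSummable_odeCoeff ha α β
  set c := odeCoeff a α β with hcdef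
  have hd := fun z hz => hc.hasDerivAt (z := z) hz
  have hd2 := fun z hz => hc.derivative.hasDerivAt (z := z) hz
  have hzero : ∀ d : ℕ → ℂ, ∑' n, d n * (0 : ℂ) ^ n = d 0 := by
    intro d
    rw [tsum_eq_single 0 (by intro n hn; simp [hn])]; simp
  refine ⟨fun w => ∑' n, c n * w ^ n, fun z hz => (hd z hz).differentiableAt.differentiableWithinAt,
    fun z hz => ?_, ?_, ?_⟩
  · have h1 : deriv (fun w => ∑' n, c n * w ^ n) =ᶠ[𝓝 z]
        fun w => ∑' n : ℕ, (((n : ℂ) + 1) * c (n + 1)) * w ^ n := by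
      filter_upwards [isOpen_unitDisc.mem_nhds hz] with w hw using (hd w hw).deriv
    rw [h1.deriv_eq, (hd2 z hz).deriv, hAa z hz, mul_comm]
    have hz1 := mem_unitDisc.1 hz
    have s1 : Summable fun n => ‖c n * z ^ n‖ := by
      simpa [norm_mul, norm_pow] using hc ‖z‖ (norm_nonneg _) hz1
    have s2 : Summable fun n => ‖a n * z ^ n‖ := by
      simpa [norm_mul, norm_pow] using ha ‖z‖ (norm_nonneg _) hz1
    rw [tsum_mul_tsum_eq_tsum_sum_antidiagonal_of_summable_norm s1 s2]
    have h2 : ∀ n : ℕ, ((n : ℂ) + 1) * ((((n + 1 : ℕ) : ℂ) + 1) * c (n + 1 + 1)) * z ^ n =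
        -∑ p ∈ Finset.HasAntidiagonal.antidiagonal n, (c p.1 * z ^ p.1) * (a p.2 * z ^ p.2) := by
      intro n
      have := odeCoeff_add_two a α β n
      have e : (((n + 1 : ℕ) : ℂ) + 1) = (n : ℂ) + 2 := by push_cast; ring
      rw [e, this, neg_mul, Finset.sum_mul]
      congr 1
      refine Finset.sum_congr rfl fun p hp => ?_
      rw [← Finset.HasAntidiagonal.mem_antidiagonal.1 hp, pow_add]; ring
    simp_rw [h2]
    rw [tsum_neg, neg_add_cancel]
  · simp only [hzero]; rw [hcdef, odeCoeff]
  · rw [(hd 0 zero_mem_unitDisc).deriv, hzero, hcdef]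
    simp [odeCoeff]

/-! ### Solutions under Möbius changes of variable, and initial value problems at any point. -/

/-- `f` is an analytic solution in the unit disc of `f'' + A f = 0`. -/
structure IsSolution (A f : ℂ → ℂ) : Prop where
  differentiableOn : DifferentiableOn ℂ f unitDisc
  equation : ∀ z ∈ unitDisc, deriv (deriv f) z + A z * f z = 0

theorem IsNontrivialSolution.isSolution {A f : ℂ → ℂ} (h : IsNontrivialSolution A f) :
    IsSolution A f :=
  ⟨h.analytic.differentiableOn, h.equation⟩

namespace IsSolution

variable {A f : ℂ → ℂ}

theorem isNontrivialSolution (h : IsSolution A f) {z : ℂ} (hz : z ∈ unitDisc) (hfz : f z ≠ 0) :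
    IsNontrivialSolution A f :=
  ⟨h.differentiableOn.analyticOnNhd isOpen_unitDisc, h.equation, z, hz, hfz⟩

theorem hasDerivAt (h : IsSolution A f) {z : ℂ} (hz : z ∈ unitDisc) :
    HasDerivAt f (deriv f z) z :=
  (h.differentiableOn.differentiableAt (isOpen_unitDisc.mem_nhds hz)).hasDerivAt

theorem hasDerivAt_deriv (h : IsSolution A f) {z : ℂ} (hz : z ∈ unitDisc) :
    HasDerivAt (deriv f) (-(A z * f z)) z := by
  have := ((h.differentiableOn.deriv isOpen_unitDisc).differentiableAt
    (isOpen_unitDisc.mem_nhds hz)).hasDerivAt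
  rwa [eq_neg_of_add_eq_zero_left (h.equation z hz)] at this

theorem of_hasDerivAt {f' : ℂ → ℂ} (h : ∀ z ∈ unitDisc, HasDerivAt f (f' z) z)
    (h' : ∀ z ∈ unitDisc, HasDerivAt f' (-(A z * f z)) z) : IsSolution A f := by
  refine ⟨fun z hz => (h z hz).differentiableAt.differentiableWithinAt, fun z hz => ?_⟩
  have : deriv f =ᶠ[𝓝 z] f' := by
    filter_upwards [isOpen_unitDisc.mem_nhds hz] with w hw using (h w hw).deriv
  rw [this.deriv_eq, (h' z hz).deriv, neg_add_cancel]

theorem add_const_mul {g : ℂ → ℂ} (hf : IsSolution A f) (hg : IsSolution A g) (c : ℂ) :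
    IsSolution A fun z => f z + c * g z := by
  refine of_hasDerivAt (f' := fun z => deriv f z + c * deriv g z)
    (fun z hz => (hf.hasDerivAt hz).add ((hg.hasDerivAt hz).const_mul c)) (fun z hz => ?_)
  convert! (hf.hasDerivAt_deriv hz).add ((hg.hasDerivAt_deriv hz).const_mul c) using 1
  ring

/-- Solutions pull back under Möbius transformations. -/
theorem mobius (hf : IsSolution A f) {α β γ δ : ℂ}
    (hne : ∀ w ∈ unitDisc, γ * w + δ ≠ 0)
    (hmaps : ∀ w ∈ unitDisc, (α * w + β) / (γ * w + δ) ∈ unitDisc) :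
    IsSolution
        (fun w => A ((α * w + β) / (γ * w + δ)) * ((α * δ - β * γ) / (γ * w + δ) ^ 2) ^ 2)
        (fun w => (γ * w + δ) * f ((α * w + β) / (γ * w + δ))) ∧
      ∀ w ∈ unitDisc, HasDerivAt (fun w => (γ * w + δ) * f ((α * w + β) / (γ * w + δ)))
        (γ * f ((α * w + β) / (γ * w + δ)) +
          deriv f ((α * w + β) / (γ * w + δ)) * ((α * δ - β * γ) / (γ * w + δ))) w := by
  have hden : ∀ w, HasDerivAt (fun w => γ * w + δ) γ w := fun w => by
    simpa using ((hasDerivAt_id w).const_mul γ).add_const δ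
  have hnum : ∀ w, HasDerivAt (fun w => α * w + β) α w := fun w => by
    simpa using ((hasDerivAt_id w).const_mul α).add_const β
  have hM : ∀ w ∈ unitDisc, HasDerivAt (fun w => (α * w + β) / (γ * w + δ))
      ((α * δ - β * γ) / (γ * w + δ) ^ 2) w := fun w hw => by
    convert! (hnum w).div (hden w) (hne w hw) using 1
    ring
  have h1 : ∀ w ∈ unitDisc, HasDerivAt (fun w => (γ * w + δ) * f ((α * w + β) / (γ * w + δ)))
        (γ * f ((α * w + β) / (γ * w + δ)) +
          deriv f ((α * w + β) / (γ * w + δ)) * ((α * δ - β * γ) / (γ * w + δ))) w := by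
    intro w hw
    have := hne w hw
    convert! (hden w).mul (HasDerivAt.comp w (hf.hasDerivAt (hmaps w hw)) (hM w hw)) using 1
    simp only [Function.comp]
    field_simp
  -- The derivative of the Möbius map is a constant over `(γ * w + δ) ^ 2`. With the weight `γ * w +
  -- δ` in front, the terms containing `deriv f` cancel in the second derivative.
  refine ⟨of_hasDerivAt h1 fun w hw => ?_, h1⟩
  have := hne w hw
  have hc1 := HasDerivAt.comp w (hf.hasDerivAt (hmaps w hw)) (hM w hw)
  have hc2 := HasDerivAt.comp w (hf.hasDerivAt_deriv (hmaps w hw)) (hM w hw)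
  have hq : HasDerivAt (fun w => (α * δ - β * γ) / (γ * w + δ))
      (-((α * δ - β * γ) * γ) / (γ * w + δ) ^ 2) w := by
    convert! (hasDerivAt_const w (α * δ - β * γ)).div (hden w) this using 1
    ring
  convert! (hc1.const_mul γ).add (hc2.mul hq) using 1
  simp only [Function.comp]
  field_simp
  ring

end IsSolution

/-- Divided by `‖1 + conj a * w‖ ^ 2`, this is the Schwarz–Pick equality `1 - |M|² = |M'| (1 -
|w|²)` for disc automorphisms. It gives both the self-map property and the invariance of Nehari's
condition. -/
theorem normSq_one_add_conj_mul_sub (a w : ℂ) :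
    ‖1 + (starRingEnd ℂ) a * w‖ ^ 2 - ‖w + a‖ ^ 2 = (1 - ‖a‖ ^ 2) * (1 - ‖w‖ ^ 2) := by
  simp only [← Complex.normSq_eq_norm_sq, Complex.normSq_apply, Complex.add_re, Complex.add_im,
    Complex.mul_re, Complex.mul_im, Complex.conj_re, Complex.conj_im, Complex.one_re,
    Complex.one_im]
  ring

theorem one_add_conj_mul_ne_zero {a w : ℂ} (ha : a ∈ unitDisc) (hw : w ∈ unitDisc) :
    1 + (starRingEnd ℂ) a * w ≠ 0 := by
  rw [mem_unitDisc] at ha hw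
  intro h
  have h1 : (starRingEnd ℂ) a * w = -1 := by linear_combination h
  have h2 := congrArg norm h1
  rw [norm_mul, RCLike.norm_conj, norm_neg, norm_one] at h2
  nlinarith [norm_nonneg a, norm_nonneg w]

theorem mobius_mem_unitDisc {a w : ℂ} (ha : a ∈ unitDisc) (hw : w ∈ unitDisc) :
    (w + a) / (1 + (starRingEnd ℂ) a * w) ∈ unitDisc := by
  have h0 := one_add_conj_mul_ne_zero ha hw
  have h := normSq_one_add_conj_mul_sub a w
  rw [mem_unitDisc] at *
  rw [norm_div, div_lt_one (norm_pos_iff.2 h0)]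
  refine lt_of_pow_lt_pow_left₀ 2 (norm_nonneg _) ?_
  have : 0 < (1 - ‖a‖ ^ 2) * (1 - ‖w‖ ^ 2) :=
    mul_pos (by nlinarith [norm_nonneg a]) (by nlinarith [norm_nonneg w])
  linarith

/-- An automorphism taking `0` to `a` reduces the problem to initial data at the origin for the
pulled-back coefficient; the inverse automorphism carries the solution back. -/
theorem exists_isSolution {A : ℂ → ℂ} (hA : DifferentiableOn ℂ A unitDisc) {a : ℂ}
    (ha : a ∈ unitDisc) (p q : ℂ) :
    ∃ f : ℂ → ℂ, IsSolution A f ∧ f a = p ∧ deriv f a = q := by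
  have ha' : -a ∈ unitDisc := by simpa [mem_unitDisc] using ha
  set a' := (starRingEnd ℂ) a with ha'def
  set D : ℂ := 1 - a' * a with hD
  have hD0 : D ≠ 0 := by
    have := one_add_conj_mul_ne_zero ha' ha
    simpa [hD, sub_eq_add_neg] using this
  set M : ℂ → ℂ := fun w => (w + a) / (1 + a' * w) with hM
  have hMd : DifferentiableOn ℂ M unitDisc :=
    DifferentiableOn.fun_div (by fun_prop) (by fun_prop) fun w hw => one_add_conj_mul_ne_zero ha hw
  have hBd : DifferentiableOn ℂ (fun w => A (M w) * (D / (1 + a' * w) ^ 2) ^ 2) unitDisc :=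
    (hA.comp hMd fun w hw => mobius_mem_unitDisc ha hw).fun_mul
      (DifferentiableOn.fun_pow (DifferentiableOn.fun_div (by fun_prop) (by fun_prop)
        fun w hw => pow_ne_zero 2 (one_add_conj_mul_ne_zero ha hw)) 2)
  -- The pull-back will be `f w = (1 - a' w) g(M⁻¹ w)`, with `f a = D * g 0` and `deriv f a = -a' *
  -- g 0 + deriv g 0`. The data for `g` solve these equations for `p` and `q`.
  obtain ⟨g, hg, hg2, hg0, hg1⟩ := exists_solution_at_zero hBd (p / D) (q + a' * p / D)
  have hne : ∀ w ∈ unitDisc, -a' * w + 1 ≠ 0 := fun w hw => by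
    have := one_add_conj_mul_ne_zero ha' hw
    rw [map_neg] at this
    rwa [add_comm]
  have hmaps : ∀ w ∈ unitDisc, (1 * w + -a) / (-a' * w + 1) ∈ unitDisc := fun w hw => by
    have := mobius_mem_unitDisc ha' hw
    rw [map_neg] at this
    rwa [one_mul, add_comm (-a' * w)]
  obtain ⟨hs, hs'⟩ := IsSolution.mobius ⟨hg, hg2⟩ hne hmaps
  have hz0 : (1 * a + -a) / (-a' * a + 1) = 0 := by simp
  have hDa : -a' * a + 1 = D := by rw [hD]; ring
  refine ⟨_, ⟨hs.1, fun z hz => ?_⟩, ?_, ?_⟩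
  · have h1 := hs.2 z hz
    have h2 := hne z hz
    obtain ⟨E, hE⟩ : ∃ E, E = -a' * z + 1 := ⟨_, rfl⟩
    have h3 := one_add_conj_mul_ne_zero ha (hmaps z hz)
    rw [← ha'def] at h3
    have key : (-a' * z + 1) * (1 + a' * ((1 * z + -a) / (-a' * z + 1))) = D := by
      rw [← hE] at h2 ⊢
      field_simp
      rw [hD, hE]; ring
    have key2 : M ((1 * z + -a) / (-a' * z + 1)) = z := by
      simp only [hM]
      rw [div_eq_iff h3]
      rw [← hE] at h2 ⊢
      field_simp
      rw [hE]; ring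
    -- The derivatives of the automorphism and of its inverse multiply to `1`, so pulling back twice
    -- restores `A`.
    have key3 : (D / (1 + a' * ((1 * z + -a) / (-a' * z + 1))) ^ 2) ^ 2 *
        ((1 * 1 - -a * -a') / (-a' * z + 1) ^ 2) ^ 2 = 1 := by
      have e : (1 * 1 - -a * -a') = D := by rw [hD]; ring
      rw [e, ← mul_pow, div_mul_div_comm, ← mul_pow, mul_comm (1 + _), key, sq D,
        div_self (mul_ne_zero hD0 hD0), one_pow]
    rw [key2, mul_assoc (A z), key3, mul_one] at h1
    exact h1
  · rw [hz0, hDa, hg0]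
    field_simp
  · rw [(hs' a ha).deriv, hz0, hDa, hg0, hg1]
    have e : (1 * 1 - -a * -a') = D := by rw [hD]; ring
    rw [e]
    field_simp
    ring

/-! ### Sturm comparison and Nehari's criterion. -/

/-- A Sturm comparison with the equation `u'' + (1 - t ^ 2)⁻² u = 0`, whose solution
`√(1 - t ^ 2)` does not vanish in `(-1, 1)`. -/
theorem eq_zero_of_sturm {r : ℝ} (hr0 : 0 ≤ r) (hr1 : r < 1) {v v₁ v₂ : ℝ → ℂ}
    (hv : ∀ t ∈ Set.Icc 0 r, HasDerivAt v (v₁ t) t)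
    (hv₁ : ∀ t ∈ Set.Icc 0 r, HasDerivAt v₁ (v₂ t) t)
    (hle : ∀ t ∈ Set.Icc 0 r, ‖v₂ t‖ * (1 - t ^ 2) ^ 2 ≤ ‖v t‖)
    (h0 : v 0 = 0) (hr : v r = 0) : ∀ t ∈ Set.Icc 0 r, v t = 0 := by
  have hre : ∀ {g g' : ℝ → ℂ} {t : ℝ}, HasDerivAt g (g' t) t →
      HasDerivAt (fun t => (g t).re) (g' t).re t ∧ HasDerivAt (fun t => (g t).im) (g' t).im t :=
    fun h => ⟨Complex.reCLM.hasFDerivAt.comp_hasDerivAt _ h,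
      Complex.imCLM.hasFDerivAt.comp_hasDerivAt _ h⟩
  have hpos : ∀ t ∈ Set.Icc 0 r, 0 < 1 - t ^ 2 := fun t ht => by nlinarith [ht.1, ht.2]
  -- `φ` is `(1 - t²) / 2` times the derivative of `|v|² / (1 - t²)`. Its own derivative is `|v₁ + t
  -- v / (1 - t²)|² + Re(conj v * v₂) + |v|² / (1 - t²)²`, nonnegative by `hle`. As `φ` vanishes at
  -- both ends it is zero throughout, so `|v|² / (1 - t²)` is constant, equal to its value `0` at `t
  -- = 0`.
  set φ : ℝ → ℝ := fun t => (v t).re * (v₁ t).re + (v t).im * (v₁ t).im +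
    t / (1 - t ^ 2) * ((v t).re ^ 2 + (v t).im ^ 2) with hφ
  have hpoly : ∀ t : ℝ, HasDerivAt (fun t : ℝ => 1 - t ^ 2) (-(2 * t)) t := fun t => by
    simpa using (hasDerivAt_pow 2 t).const_sub 1
  have hφ' : ∀ t ∈ Set.Icc 0 r, ∃ d, 0 ≤ d ∧ HasDerivAt φ d t := by
    intro t ht
    obtain ⟨hx, hy⟩ := hre (hv t ht)
    obtain ⟨hx₁, hy₁⟩ := hre (hv₁ t ht)
    have hp := hpos t ht
    refine ⟨_, ?_, ((hx.mul hx₁).add (hy.mul hy₁)).add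
      (((hasDerivAt_id t).div (hpoly t) hp.ne').mul ((hx.pow 2).add (hy.pow 2)))⟩
    have hb : -((v t).re * (v₂ t).re + (v t).im * (v₂ t).im) * (1 - t ^ 2) ^ 2 ≤
        (v t).re ^ 2 + (v t).im ^ 2 := by
      have h1 : |((starRingEnd ℂ) (v t) * v₂ t).re| ≤ ‖v t‖ * ‖v₂ t‖ := by
        simpa using Complex.abs_re_le_norm ((starRingEnd ℂ) (v t) * v₂ t)
      have h2 : ((starRingEnd ℂ) (v t) * v₂ t).re =
          (v t).re * (v₂ t).re + (v t).im * (v₂ t).im := by simp [Complex.mul_re]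
      have h3 : ‖v t‖ * ‖v t‖ = (v t).re ^ 2 + (v t).im ^ 2 := by
        rw [← sq, ← Complex.normSq_eq_norm_sq, Complex.normSq_apply]; ring
      rw [h2] at h1
      calc _ ≤ (‖v t‖ * ‖v₂ t‖) * (1 - t ^ 2) ^ 2 := by
            gcongr; exact (neg_le_abs _).trans h1
        _ = ‖v t‖ * (‖v₂ t‖ * (1 - t ^ 2) ^ 2) := by ring
        _ ≤ ‖v t‖ * ‖v t‖ := by gcongr; exact hle t ht
        _ = _ := h3
    have hb' : 0 ≤ (v t).re * (v₂ t).re + (v t).im * (v₂ t).im +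
        ((v t).re ^ 2 + (v t).im ^ 2) / (1 - t ^ 2) ^ 2 := by
      have := (le_div_iff₀ (pow_pos hp 2)).2 hb
      linarith
    have hsq : 0 ≤ ((v₁ t).re + t / (1 - t ^ 2) * (v t).re) ^ 2 +
      ((v₁ t).im + t / (1 - t ^ 2) * (v t).im) ^ 2 := by positivity
    refine (add_nonneg hsq hb').trans_eq ?_
    simp only [id, Pi.div_apply]
    obtain ⟨E, hE⟩ : ∃ E, E = 1 - t ^ 2 := ⟨_, rfl⟩
    have hE' : t ^ 2 = 1 - E := by rw [hE]; ring
    rw [← hE] at hp ⊢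
    have := hp.ne'
    field_simp
    rw [show t ^ 2 = 1 - E from hE']
    ring_nf
    rw [hE']
    ring
  have hcφ : ContinuousOn φ (Set.Icc 0 r) := fun t ht => by
    obtain ⟨d, -, hd⟩ := hφ' t ht
    exact hd.continuousAt.continuousWithinAt
  have hmono : MonotoneOn φ (Set.Icc 0 r) := by
    refine monotoneOn_of_deriv_nonneg (convex_Icc 0 r) hcφ (fun t ht => ?_) fun t ht => ?_
    all_goals
      obtain ⟨d, hd0, hd⟩ := hφ' t (interior_subset ht)
    · exact hd.differentiableAt.differentiableWithinAt
    · rwa [hd.deriv]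
  have hφ0 : ∀ t ∈ Set.Icc 0 r, φ t = 0 := fun t ht => by
    have e0 : φ 0 = 0 := by simp [hφ, h0]
    have er : φ r = 0 := by simp [hφ, hr]
    refine le_antisymm ?_ ?_
    · rw [← er]; exact hmono ht (Set.right_mem_Icc.2 hr0) ht.2
    · rw [← e0]; exact hmono (Set.left_mem_Icc.2 hr0) ht ht.1
  have hN : ∀ t ∈ Set.Icc 0 r,
      HasDerivAt (fun t => ((v t).re ^ 2 + (v t).im ^ 2) / (1 - t ^ 2)) 0 t := by
    intro t ht
    obtain ⟨hx, hy⟩ := hre (hv t ht)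
    have hp := (hpos t ht).ne'
    have h := hφ0 t ht
    simp only [hφ] at h
    convert! ((hx.pow 2).add (hy.pow 2)).div (hpoly t) hp using 1
    field_simp at h
    rw [eq_comm, div_eq_zero_iff]
    left
    simp only [Pi.add_apply, Pi.pow_apply]
    linear_combination 2 * h
  intro t ht
  have hc := constant_of_has_deriv_right_zero
    (fun t ht => (hN t ht).continuousAt.continuousWithinAt)
    (fun t ht => (hN t (Set.Ico_subset_Icc_self ht)).hasDerivWithinAt) t ht
  simp only [h0] at hc
  have h1 : (v t).re ^ 2 + (v t).im ^ 2 = 0 := by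
    have := (hpos t ht).ne'
    field_simp at hc
    simpa using hc
  exact Complex.ext (by simp; nlinarith [sq_nonneg (v t).re, sq_nonneg (v t).im])
    (by simp; nlinarith [sq_nonneg (v t).re, sq_nonneg (v t).im])

/-- Nehari's criterion, in terms of zeros of solutions. -/
theorem IsSolution.eq_zero_of_nehari {B g : ℂ → ℂ} (hg : IsSolution B g)
    (hB : ∀ w ∈ unitDisc, ‖B w‖ * (1 - ‖w‖ ^ 2) ^ 2 ≤ 1) {a b : ℂ} (ha : a ∈ unitDisc)
    (hb : b ∈ unitDisc) (hab : a ≠ b) (hga : g a = 0) (hgb : g b = 0) :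
    ∀ z ∈ unitDisc, g z = 0 := by
  have ha' : -a ∈ unitDisc := by simpa [mem_unitDisc] using ha
  -- `c` is the image of `b` under the automorphism sending `a` to `0`. The unimodular factor `e`
  -- rotates it to the positive number `r`, so the zeros `a` and `b` correspond to `0` and `r`.
  set c := (b - a) / (1 - (starRingEnd ℂ) a * b) with hc
  have hcd : c ∈ unitDisc := by
    simpa [hc, sub_eq_add_neg] using mobius_mem_unitDisc ha' hb
  have hden : 1 - (starRingEnd ℂ) a * b ≠ 0 := by
    simpa [sub_eq_add_neg] using one_add_conj_mul_ne_zero ha' hb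
  have hc0 : c ≠ 0 := div_ne_zero (sub_ne_zero.2 hab.symm) hden
  set r := ‖c‖ with hr
  have hr0 : 0 < r := norm_pos_iff.2 hc0
  have hr1 : r < 1 := mem_unitDisc.1 hcd
  set e : ℂ := c / r with he
  have her : e * r = c := by
    have : (r : ℂ) ≠ 0 := by exact_mod_cast hr0.ne'
    rw [he]; field_simp
  have he1 : ‖e‖ = 1 := by
    rw [he, norm_div, Complex.norm_real, norm_norm, div_self hr0.ne']
  set a' := (starRingEnd ℂ) a with ha'def
  have hew : ∀ w ∈ unitDisc, e * w ∈ unitDisc := fun w hw => by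
    rw [mem_unitDisc] at *
    simpa [he1] using hw
  have hne : ∀ w ∈ unitDisc, a' * e * w + 1 ≠ 0 := fun w hw => by
    rw [add_comm, mul_assoc]; exact one_add_conj_mul_ne_zero ha (hew w hw)
  have hmaps : ∀ w ∈ unitDisc, (e * w + a) / (a' * e * w + 1) ∈ unitDisc := fun w hw => by
    rw [add_comm (a' * e * w), mul_assoc]; exact mobius_mem_unitDisc ha (hew w hw)
  obtain ⟨hG, -⟩ := hg.mobius hne hmaps
  set G : ℂ → ℂ := fun w => (a' * e * w + 1) * g ((e * w + a) / (a' * e * w + 1)) with hGdef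
  have hmem : ∀ t ∈ Set.Icc 0 r, (t : ℂ) ∈ unitDisc := fun t ht => by
    rw [mem_unitDisc, Complex.norm_real, Real.norm_of_nonneg ht.1]; exact ht.2.trans_lt hr1
  have hD : e * 1 - a * (a' * e) = e * (1 - ‖a‖ ^ 2) := by
    have : a * a' = (‖a‖ : ℂ) ^ 2 := Complex.mul_conj' a
    linear_combination (-e) * this
  have ha1 : 0 < 1 - ‖a‖ ^ 2 := by
    have := mem_unitDisc.1 ha
    nlinarith [norm_nonneg a]
  have hzero := eq_zero_of_sturm hr0.le hr1 (v := fun t => G t)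
    (fun t ht => (hG.hasDerivAt (hmem t ht)).comp_ofReal)
    (fun t ht => (hG.hasDerivAt_deriv (hmem t ht)).comp_ofReal)
    (fun t ht => by
      have hw := hmem t ht
      have hq := hB _ (hmaps t hw)
      have hid := normSq_one_add_conj_mul_sub a (e * t)
      rw [← ha'def, norm_mul e, he1, one_mul, Complex.norm_real, Real.norm_of_nonneg ht.1,
        ← mul_assoc, add_comm 1 (a' * e * t)] at hid
      rw [norm_div] at hq
      rw [norm_neg, norm_mul, norm_mul, norm_pow, norm_div, norm_pow, hD, norm_mul, he1, one_mul]
      have hn : ‖(1 - (‖a‖ : ℂ) ^ 2)‖ = 1 - ‖a‖ ^ 2 := by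
        rw [← Complex.ofReal_pow, ← Complex.ofReal_one, ← Complex.ofReal_sub, Complex.norm_real,
          Real.norm_of_nonneg ha1.le]
      rw [hn]
      have hX : 0 < ‖a' * e * (t : ℂ) + 1‖ := norm_pos_iff.2 (hne t hw)
      set X := ‖a' * e * (t : ℂ) + 1‖
      set Y := ‖e * (t : ℂ) + a‖
      set b := ‖B ((e * t + a) / (a' * e * t + 1))‖
      -- Schwarz–Pick equality: the bound on `B` at the image point becomes the same bound for the
      -- pulled-back coefficient at `t`.
      have h4 : (1 - ‖a‖ ^ 2) / X ^ 2 * (1 - t ^ 2) = 1 - (Y / X) ^ 2 := by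
        field_simp
        linarith
      calc b * ((1 - ‖a‖ ^ 2) / X ^ 2) ^ 2 * ‖G t‖ * (1 - t ^ 2) ^ 2
          = (b * ((1 - ‖a‖ ^ 2) / X ^ 2 * (1 - t ^ 2)) ^ 2) * ‖G t‖ := by ring
        _ ≤ 1 * ‖G t‖ := by
            rw [h4]; gcongr
        _ = ‖G t‖ := one_mul _)
    (by simp [hGdef, hga])
    (by
      have h1 : (e * (r : ℂ) + a) / (a' * e * r + 1) = b := by
        rw [mul_assoc, her, div_eq_iff]
        · obtain ⟨E, hE⟩ : ∃ E, E = 1 - a' * b := ⟨_, rfl⟩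
          rw [hc, ← hE]
          rw [← hE] at hden
          field_simp
          rw [hE]; ring
        · rw [← her, ← mul_assoc]; exact hne r (hmem r ⟨hr0.le, le_rfl⟩)
      simp only [hGdef]
      rw [h1, hgb, mul_zero])
  -- The zeros on `[0, r]` map to a curve of zeros of `g` ending at `a`, so the identity theorem
  -- applies.
  have htend : Tendsto (fun t : ℝ => (e * t + a) / (a' * e * t + 1)) (𝓝[>] 0) (𝓝[≠] a) := by
    refine tendsto_nhdsWithin_iff.2 ⟨?_, ?_⟩
    · have : ContinuousAt (fun t : ℝ => (e * t + a) / (a' * e * t + 1)) 0 :=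
        ContinuousAt.div (by fun_prop) (by fun_prop) (by simp)
      have h2 := this.tendsto
      simp only [Complex.ofReal_zero, mul_zero, zero_add, div_one] at h2
      exact h2.mono_left nhdsWithin_le_nhds
    · filter_upwards [Ioc_mem_nhdsGT hr0] with t ht heq
      rw [Set.mem_singleton_iff, div_eq_iff (hne t (hmem t ⟨ht.1.le, ht.2⟩))] at heq
      have h3 : (e * 1 - a * (a' * e)) * t = 0 := by linear_combination heq
      rw [hD] at h3
      have h5 : (1 - (‖a‖ : ℂ) ^ 2) ≠ 0 := by exact_mod_cast ha1.ne'
      have h6 : e ≠ 0 := norm_pos_iff.1 (he1 ▸ one_pos)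
      have h7 : (t : ℂ) ≠ 0 := by exact_mod_cast ht.1.ne'
      exact mul_ne_zero (mul_ne_zero h6 h5) h7 h3
  have hfreq : ∃ᶠ z in 𝓝[≠] a, g z = 0 := by
    refine htend.frequently (Eventually.frequently ?_)
    filter_upwards [Ioc_mem_nhdsGT hr0] with t ht
    have h1 := hzero t ⟨ht.1.le, ht.2⟩
    exact (mul_eq_zero.1 h1).resolve_left (hne t (hmem t ⟨ht.1.le, ht.2⟩))
  exact (hg.differentiableOn.analyticOnNhd
    isOpen_unitDisc).eqOn_zero_of_preconnected_of_frequently_eq_zero isPreconnected_unitDisc ha hfreq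

/-! ### From the growth bound to separated zeros: part (i). -/

/-- The elementary inequality behind the localization to discs of radius `ρ = (1 + C)⁻¹`: here
`x = 1 - ‖ζ + ρ w‖` and `y = 1 - ‖w‖`. -/
theorem localization_inequality {C ρ x y : ℝ} (hC : 0 < C) (hρ : ρ * (1 + C) = 1) (hy0 : 0 < y)
    (hy1 : y ≤ 1) (hxy : ρ * y ≤ x) (hx1 : x ≤ 1) :
    ρ ^ 2 * (y * (2 - y)) ^ 2 * (1 + C * x) ≤ (x * (2 - x)) ^ 2 := by
  have hρ0 : 0 < ρ := by
    by_contra h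
    nlinarith
  have hρ1 : ρ < 1 := by nlinarith
  have hρC : ρ * C = 1 - ρ := by linarith
  have hx0 : 0 < x := (mul_pos hρ0 hy0).trans_le hxy
  rcases le_total x ρ with h | h
  · obtain ⟨s, rfl⟩ : ∃ s, x = ρ * s := ⟨x / ρ, by field_simp⟩
    have hys : y ≤ s := le_of_mul_le_mul_left hxy hρ0
    have hs1 : s ≤ 1 := by nlinarith
    have h1 : y * (2 - y) ≤ s * (2 - s) := by nlinarith
    have h2 : C * (ρ * s) = (1 - ρ) * s := by rw [← hρC]; ring
    have h3 : 0 ≤ y * (2 - y) := mul_nonneg hy0.le (by linarith)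
    -- With `x = ρ s` and `y` replaced by the larger `s`, what remains is `(2 - s)² (1 + (1 - ρ) s)
    -- ≤ (2 - ρ s)²`. The right side minus the left side is exactly this product.
    have h4 : 0 ≤ (1 - ρ) * s ^ 2 * (3 - ρ - s) :=
      mul_nonneg (mul_nonneg (by linarith) (sq_nonneg s)) (by linarith)
    have h5 : 0 ≤ (1 - ρ) * s := mul_nonneg (by linarith) (hy0.le.trans hys)
    rw [h2]
    calc ρ ^ 2 * (y * (2 - y)) ^ 2 * (1 + (1 - ρ) * s)
        ≤ ρ ^ 2 * (s * (2 - s)) ^ 2 * (1 + (1 - ρ) * s) := by gcongr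
      _ = (ρ * s) ^ 2 * ((2 - s) ^ 2 * (1 + (1 - ρ) * s)) := by ring
      _ ≤ (ρ * s) ^ 2 * (2 - ρ * s) ^ 2 := by
          gcongr
          linarith
      _ = _ := by ring
  · have h1 : y * (2 - y) ≤ 1 := by nlinarith [sq_nonneg (1 - y)]
    have h3 : 0 ≤ y * (2 - y) := mul_nonneg hy0.le (by linarith)
    have h4 : 1 ≤ 2 - x := by linarith
    calc ρ ^ 2 * (y * (2 - y)) ^ 2 * (1 + C * x)
        ≤ ρ ^ 2 * 1 ^ 2 * (1 + C * x) := by gcongr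
      _ = ρ ^ 2 * (1 - x) + ρ * x := by linear_combination ρ * x * hρC
      _ ≤ x ^ 2 * (1 - x) + x * x := by gcongr
      _ = x ^ 2 * (2 - x) := by ring
      _ ≤ x ^ 2 * ((2 - x) * (2 - x)) := by gcongr; nlinarith
      _ = _ := by ring

/-- A growth bound on the coefficient separates the zeros of solutions in the discs of radius
`(1 + C)⁻¹`. -/
theorem atMostOneZeroInDiscs_of_norm_le {A : ℂ → ℂ} {C : ℝ} (hC : 0 < C)
    (hA : ∀ z ∈ unitDisc, ‖A z‖ * (1 - ‖z‖ ^ 2) ^ 2 ≤ 1 + C * (1 - ‖z‖)) :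
    AtMostOneZeroInDiscs A C := by
  intro f hf ζ hζ z₁ hz₁ z₂ hz₂
  by_contra hne
  set ρ : ℝ := (1 + C)⁻¹ with hρ
  have hρ0 : 0 < ρ := by positivity
  have hρC : ρ * (1 + C) = 1 := inv_mul_cancel₀ (by positivity)
  have hζ' : ‖ζ‖ ≤ 1 - ρ := by
    refine hζ.trans_eq ?_
    rw [div_eq_mul_inv, ← hρ]; linarith
  have hρ0' : (ρ : ℂ) ≠ 0 := by exact_mod_cast hρ0.ne'
  have hnorm : ∀ w : ℂ, ‖(ρ : ℂ) * w + ζ‖ ≤ 1 - ρ * (1 - ‖w‖) := fun w => by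
    have := norm_add_le ((ρ : ℂ) * w) ζ
    rw [norm_mul, Complex.norm_real, Real.norm_of_nonneg hρ0.le] at this
    linarith
  have hmaps : ∀ w ∈ unitDisc, ((ρ : ℂ) * w + ζ) / (0 * w + 1) ∈ unitDisc := fun w hw => by
    rw [zero_mul, zero_add, div_one]
    rw [mem_unitDisc] at *
    refine (hnorm w).trans_lt ?_
    nlinarith
  obtain ⟨hg, -⟩ := hf.isSolution.mobius (γ := 0) (δ := 1) (by simp) hmaps
  simp only [zero_mul, zero_add, div_one, one_mul, mul_one, mul_zero, sub_zero, one_pow]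
    at hg hmaps
  have hpre : ∀ z ∈ Metric.ball ζ ρ, (z - ζ) / ρ ∈ unitDisc ∧ (ρ : ℂ) * ((z - ζ) / ρ) + ζ = z := by
    intro z hz
    refine ⟨?_, by field_simp; ring⟩
    rw [mem_unitDisc, norm_div, Complex.norm_real, Real.norm_of_nonneg hρ0.le, div_lt_one hρ0]
    exact mem_ball_iff_norm.1 hz
  obtain ⟨h1, h1'⟩ := hpre z₁ hz₁.1
  obtain ⟨h2, h2'⟩ := hpre z₂ hz₂.1
  have hzero := hg.eq_zero_of_nehari (fun w hw => by
      have hq := hA _ (hmaps w hw)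
      have hn := hnorm w
      have hx := mem_unitDisc.1 (hmaps w hw)
      rw [mem_unitDisc] at hw
      set Z := ‖(ρ : ℂ) * w + ζ‖
      have hZ0 : 0 ≤ Z := norm_nonneg _
      have hloc := localization_inequality hC hρC (x := 1 - Z) (y := 1 - ‖w‖) (by linarith)
        (by linarith [norm_nonneg w]) (by linarith) (by linarith)
      rw [norm_mul, norm_pow, Complex.norm_real, Real.norm_of_nonneg hρ0.le]
      have hp : 0 < (1 - Z ^ 2) ^ 2 := by
        have : 0 < 1 - Z ^ 2 := by nlinarith
        positivity
      refine le_of_mul_le_mul_right ?_ hp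
      calc _ = (‖A (ρ * w + ζ)‖ * (1 - Z ^ 2) ^ 2) * (ρ ^ 2 * (1 - ‖w‖ ^ 2) ^ 2) := by ring
        _ ≤ (1 + C * (1 - Z)) * (ρ ^ 2 * (1 - ‖w‖ ^ 2) ^ 2) := by gcongr
        _ = ρ ^ 2 * ((1 - ‖w‖) * (2 - (1 - ‖w‖))) ^ 2 * (1 + C * (1 - Z)) := by ring
        _ ≤ ((1 - Z) * (2 - (1 - Z))) ^ 2 := hloc
        _ = 1 * (1 - Z ^ 2) ^ 2 := by ring) h1 h2
      (fun h => hne (by rw [← h1', ← h2', h])) (by rw [h1', hz₁.2]) (by rw [h2', hz₂.2])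
  obtain ⟨z, hz, hfz⟩ := hf.nontrivial
  -- The pulled-back solution vanishes identically, hence so does `f` near `z₁` and then on the
  -- whole disc.
  refine hfz (hf.analytic.eqOn_zero_of_preconnected_of_eventuallyEq_zero isPreconnected_unitDisc
    (z₀ := z₁) (h1' ▸ hmaps _ h1) ?_ hz)
  filter_upwards [Metric.isOpen_ball.mem_nhds hz₁.1] with u hu
  obtain ⟨h3, h3'⟩ := hpre u hu
  have := hzero _ h3
  rwa [h3'] at this

/-! ### The area theorem, by integration over annuli. -/

/-- The closed annulus with centre at the origin. -/
def annulus (ε r : ℝ) : Set ℂ := {z | ε ≤ ‖z‖ ∧ ‖z‖ ≤ r}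

theorem isCompact_annulus (ε r : ℝ) : IsCompact (annulus ε r) := by
  refine (isCompact_closedBall (0 : ℂ) r).of_isClosed_subset ?_ fun z hz => by
    simpa using hz.2
  exact (isClosed_le continuous_const continuous_norm).inter
    (isClosed_le continuous_norm continuous_const)

theorem integral_annulus {ε r : ℝ} (hε : 0 < ε) (hεr : ε ≤ r) {g : ℂ → ℝ}
    (hg : ContinuousOn g (annulus ε r)) :
    ∫ z in annulus ε r, g z =
      ∫ t in ε..r, t * (2 * Real.pi * Real.circleAverage g 0 t) := by
  have hms := (isCompact_annulus ε r).measurableSet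
  have hsymm : ∀ p : ℝ × ℝ, Complex.polarCoord.symm p = circleMap 0 p.1 p.2 := fun p => by
    rw [Complex.polarCoord_symm_apply, circleMap, zero_add, Complex.exp_mul_I]
    push_cast
    ring
  have hcont : Continuous fun p : ℝ × ℝ => circleMap 0 p.1 p.2 := by
    unfold circleMap; fun_prop
  have hnorm : ∀ p : ℝ × ℝ, p ∈ Set.Icc ε r ×ˢ Set.Icc (-Real.pi) Real.pi →
      circleMap 0 p.1 p.2 ∈ annulus ε r := fun p hp => by
    have h0 : 0 < p.1 := hε.trans_le hp.1.1
    rw [annulus, Set.mem_ofPred_eq, norm_circleMap_zero, abs_of_pos h0]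
    exact hp.1
  rw [← MeasureTheory.integral_indicator hms, ← Complex.integral_comp_polarCoord_symm,
    polarCoord_target]
  have h1 : ∀ p ∈ Set.Ioi (0 : ℝ) ×ˢ Set.Ioo (-Real.pi) Real.pi,
      p.1 • (annulus ε r).indicator g (Complex.polarCoord.symm p) =
        (Set.Icc ε r ×ˢ Set.Ioo (-Real.pi) Real.pi).indicator
          (fun p : ℝ × ℝ => p.1 * g (circleMap 0 p.1 p.2)) p := by
    intro p hp
    rw [hsymm]
    by_cases h : p.1 ∈ Set.Icc ε r
    · rw [Set.indicator_of_mem (hnorm p ⟨h, Set.Ioo_subset_Icc_self hp.2⟩),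
        Set.indicator_of_mem (Set.mem_prod.2 ⟨h, hp.2⟩), smul_eq_mul]
    · rw [Set.indicator_of_notMem, Set.indicator_of_notMem, smul_zero]
      · exact fun h' => h h'.1
      · rw [annulus, Set.mem_ofPred_eq, norm_circleMap_zero, abs_of_pos hp.1]
        exact h
  rw [MeasureTheory.setIntegral_congr_fun (measurableSet_Ioi.prod measurableSet_Ioo) h1,
    MeasureTheory.setIntegral_indicator (measurableSet_Icc.prod measurableSet_Ioo),
    Set.inter_eq_right.2 (Set.prod_mono
      (fun x hx => Set.mem_Ioi.2 (hε.trans_le hx.1) : Set.Icc ε r ⊆ Set.Ioi 0) subset_rfl),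
    MeasureTheory.Measure.volume_eq_prod, MeasureTheory.setIntegral_prod,
    intervalIntegral.integral_of_le hεr, MeasureTheory.integral_Icc_eq_integral_Ioc]
  · refine MeasureTheory.setIntegral_congr_fun measurableSet_Ioc fun t ht => ?_
    simp only
    rw [MeasureTheory.integral_const_mul, Real.circleAverage_eq_integral_add (-Real.pi),
      ← MeasureTheory.integral_Ioc_eq_integral_Ioo, ← intervalIntegral.integral_of_le
        (by linarith [Real.pi_pos]), intervalIntegral.integral_comp_add_right
          (fun θ => g (circleMap 0 t θ)), zero_add, smul_eq_mul]
    have : 2 * Real.pi + -Real.pi = Real.pi := by ring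
    rw [this]
    field_simp
  · rw [← MeasureTheory.Measure.volume_eq_prod]
    have hc : ContinuousOn (fun p : ℝ × ℝ => p.1 * g (circleMap 0 p.1 p.2))
        (Set.Icc ε r ×ˢ Set.Icc (-Real.pi) Real.pi) :=
      continuous_fst.continuousOn.mul (hg.comp hcont.continuousOn hnorm)
    exact (hc.integrableOn_compact (isCompact_Icc.prod isCompact_Icc)).mono_set
      (Set.prod_mono subset_rfl Set.Ioo_subset_Icc_self)

/-- The Bessel inequality on the annulus for the derivative of `w⁻¹ + b w + O(w ^ 2)`. -/
theorem le_integral_annulus_normSq {b : ℂ} {m : ℂ → ℂ} (hm : DifferentiableOn ℂ m unitDisc)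
    (hm0 : m 0 = 0) {ε r : ℝ} (hε : 0 < ε) (hεr : ε ≤ r) (hr : r < 1) :
    Real.pi * ((ε ^ 2)⁻¹ - (r ^ 2)⁻¹ + ‖b‖ ^ 2 * (r ^ 2 - ε ^ 2)) ≤
      ∫ w in annulus ε r, ‖-(w ^ 2)⁻¹ + b + m w‖ ^ 2 := by
  have hsub : annulus ε r ⊆ unitDisc := fun w hw => mem_unitDisc.2 (hw.2.trans_lt hr)
  have hne : ∀ w ∈ annulus ε r, w ≠ 0 := fun w hw h => by
    have := hw.1; rw [h, norm_zero] at this; linarith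
  have hmc : ContinuousOn m (annulus ε r) := hm.continuousOn.mono hsub
  set b' := (starRingEnd ℂ) b with hb'
  -- Twice the real part of `R ‖w‖ w` is the sum of the cross terms in `‖-(w ^ 2)⁻¹ + b + m w‖ ^ 2`;
  -- the square `‖m w‖ ^ 2` is discarded. On the circle `|w| = t` the conjugate of `w⁻²` is `w² /
  -- t⁴`, so `R t` is analytic in `w`. It vanishes at `0`, and the mean value property makes its
  -- circle average zero.
  set R : ℝ → ℂ → ℂ := fun t w => -b * w ^ 2 / (t : ℂ) ^ 4 + (-w ^ 2 / (t : ℂ) ^ 4 + b') * m w with hR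
  have hg1 : ContinuousOn (fun w : ℂ => ‖-(w ^ 2)⁻¹ + b + m w‖ ^ 2) (annulus ε r) := by
    refine (((((continuousOn_id.pow 2).inv₀ fun w hw => pow_ne_zero 2 (hne w hw)).neg.add
      continuousOn_const).add hmc).norm).pow 2
  have hg2 : ContinuousOn (fun w : ℂ => (‖w‖ ^ 4)⁻¹ + ‖b‖ ^ 2 + 2 * (R ‖w‖ w).re)
      (annulus ε r) := by
    have hn4 : ContinuousOn (fun w : ℂ => ((‖w‖ : ℝ) : ℂ) ^ 4) (annulus ε r) := by fun_prop
    have hn4' : ∀ w ∈ annulus ε r, ((‖w‖ : ℝ) : ℂ) ^ 4 ≠ 0 := fun w hw =>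
      pow_ne_zero 4 (by simpa using hne w hw)
    have h1 : ContinuousOn (fun w : ℂ => R ‖w‖ w) (annulus ε r) := by
      simp only [hR]
      exact (ContinuousOn.div (by fun_prop) hn4 hn4').add
        (((ContinuousOn.div (by fun_prop) hn4 hn4').add continuousOn_const).mul hmc)
    refine (((continuous_norm.continuousOn.pow 4).inv₀ fun w hw => ?_).add
      continuousOn_const).add ((Complex.continuous_re.comp_continuousOn h1).const_smul (2 : ℝ))
    exact pow_ne_zero 4 (norm_ne_zero_iff.2 (hne w hw))
  have hle : ∀ w ∈ annulus ε r, (‖w‖ ^ 4)⁻¹ + ‖b‖ ^ 2 + 2 * (R ‖w‖ w).re ≤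
      ‖-(w ^ 2)⁻¹ + b + m w‖ ^ 2 := by
    intro w hw
    have hw0 := hne w hw
    have hinv : (starRingEnd ℂ) (w ^ 2)⁻¹ = w ^ 2 / ((‖w‖ : ℝ) : ℂ) ^ 4 := by
      have h := Complex.mul_conj' w
      have hc0 : (starRingEnd ℂ) w ≠ 0 := (map_ne_zero _).2 hw0
      rw [map_inv₀, map_pow, show ((‖w‖ : ℝ) : ℂ) ^ 4 = (((‖w‖ : ℝ) : ℂ) ^ 2) ^ 2 by ring, ← h]
      field_simp
    have hni : ‖(w ^ 2)⁻¹‖ ^ 2 = (‖w‖ ^ 4)⁻¹ := by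
      rw [norm_inv, norm_pow, inv_pow, ← pow_mul]
    have hRw : R ‖w‖ w = -b * (starRingEnd ℂ) (w ^ 2)⁻¹ +
        (-(starRingEnd ℂ) (w ^ 2)⁻¹ + b') * m w := by
      rw [hinv]; simp only [hR]; ring
    rw [hRw, ← hni]
    obtain ⟨q, hq⟩ : ∃ q, q = (w ^ 2)⁻¹ := ⟨_, rfl⟩
    rw [← hq]
    simp only [← Complex.normSq_eq_norm_sq, Complex.normSq_apply, hb', Complex.add_re,
      Complex.add_im, Complex.mul_re, Complex.neg_re, Complex.neg_im,
      Complex.conj_re, Complex.conj_im]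
    nlinarith [sq_nonneg (m w).re, sq_nonneg (m w).im]
  refine le_trans (le_of_eq ?_) (MeasureTheory.setIntegral_mono_on
    (hg2.integrableOn_compact (isCompact_annulus ε r))
    (hg1.integrableOn_compact (isCompact_annulus ε r)) (isCompact_annulus ε r).measurableSet hle)
  rw [integral_annulus hε hεr hg2]
  have havg : ∀ t ∈ Set.uIcc ε r, t * (2 * Real.pi * Real.circleAverage
      (fun w : ℂ => (‖w‖ ^ 4)⁻¹ + ‖b‖ ^ 2 + 2 * (R ‖w‖ w).re) 0 t) =
      2 * Real.pi * ((t ^ 3)⁻¹ + ‖b‖ ^ 2 * t) := by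
    intro t ht
    rw [Set.uIcc_of_le hεr] at ht
    have ht0 : 0 < t := hε.trans_le ht.1
    have htd : Metric.closedBall (0 : ℂ) |t| ⊆ unitDisc := fun w hw => by
      rw [abs_of_pos ht0, mem_closedBall_zero_iff] at hw
      exact mem_unitDisc.2 ((hw.trans ht.2).trans_lt hr)
    have hRd : DifferentiableOn ℂ (R t) (Metric.closedBall 0 |t|) := by
      have := hm.mono htd
      simp only [hR]
      fun_prop
    have hR0 : Real.circleAverage (R t) 0 t = 0 := by
      rw [DiffContOnCl.circleAverage ⟨hRd.mono Metric.ball_subset_closedBall, ?_⟩]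
      · simp [hR, hm0]
      · rw [closure_ball _ (abs_pos.2 ht0.ne').ne']; exact hRd.continuousOn
    have hRi : CircleIntegrable (R t) 0 t :=
      (hRd.continuousOn.mono Metric.sphere_subset_closedBall).circleIntegrable'
    have hre : Real.circleAverage (fun w => (R t w).re) 0 t = 0 := by
      have := Complex.reCLM.circleAverage_comp_comm hRi
      rw [hR0, map_zero] at this
      exact this
    have hrei : CircleIntegrable (fun w => (R t w).re) 0 t :=
      (Complex.continuous_re.comp_continuousOn
        (hRd.continuousOn.mono Metric.sphere_subset_closedBall)).circleIntegrable'
    have hcongr : Real.circleAverage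
        (fun w : ℂ => (‖w‖ ^ 4)⁻¹ + ‖b‖ ^ 2 + 2 * (R ‖w‖ w).re) 0 t =
        Real.circleAverage (fun w : ℂ => ((t ^ 4)⁻¹ + ‖b‖ ^ 2) + (2 : ℝ) • (R t w).re) 0 t := by
      refine Real.circleAverage_congr_sphere fun w hw => ?_
      rw [mem_sphere_zero_iff_norm, abs_of_pos ht0] at hw
      simp [hw]
    rw [hcongr, Real.circleAverage_fun_add (circleIntegrable_const _ _ _) ?_,
      Real.circleAverage_const, Real.circleAverage_fun_smul, hre]
    · simp only [smul_zero, add_zero]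
      field_simp
    · exact hrei.const_smul
  rw [intervalIntegral.integral_congr havg, intervalIntegral.integral_eq_sub_of_hasDerivAt
    (f := fun t => Real.pi * (-(t ^ 2)⁻¹ + ‖b‖ ^ 2 * t ^ 2))]
  · ring
  · intro t ht
    rw [Set.uIcc_of_le hεr] at ht
    have ht0 : t ≠ 0 := (hε.trans_le ht.1).ne'
    have h1 := ((hasDerivAt_pow 2 t).inv (pow_ne_zero 2 ht0)).neg.add
      ((hasDerivAt_pow 2 t).const_mul (‖b‖ ^ 2))
    convert! h1.const_mul Real.pi using 1
    field_simp
    ring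
  · refine ContinuousOn.intervalIntegrable ?_
    refine continuousOn_const.mul ((ContinuousOn.inv₀ (by fun_prop) fun t ht => ?_).add
      (by fun_prop))
    rw [Set.uIcc_of_le hεr] at ht
    exact pow_ne_zero 3 (hε.trans_le ht.1).ne'

/-- The real linear map `z ↦ p z + q z̄`. -/
noncomputable def mulAddMulConj (p q : ℂ) : ℂ →L[ℝ] ℂ :=
  p • ContinuousLinearMap.id ℝ ℂ + q • (Complex.conjCLE : ℂ →L[ℝ] ℂ)

theorem mulAddMulConj_apply (p q z : ℂ) :
    mulAddMulConj p q z = p * z + q * (starRingEnd ℂ) z := by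
  simp [mulAddMulConj]

theorem det_mulAddMulConj (p q : ℂ) : (mulAddMulConj p q).det = ‖p‖ ^ 2 - ‖q‖ ^ 2 := by
  rw [ContinuousLinearMap.det, ← LinearMap.det_toMatrix Complex.basisOneI, Matrix.det_fin_two]
  simp only [LinearMap.toMatrix_apply, Complex.coe_basisOneI, ContinuousLinearMap.coe_coe,
    mulAddMulConj_apply, Complex.coe_basisOneI_repr, ← Complex.normSq_eq_norm_sq,
    Complex.normSq_apply]
  simp
  ring

theorem injective_mulAddMulConj {q : ℂ} (hq : ‖q‖ < 1) :
    Function.Injective (mulAddMulConj 1 q) := by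
  rw [injective_iff_map_eq_zero]
  intro z hz
  rw [mulAddMulConj_apply, one_mul] at hz
  by_contra h
  have h1 : ‖z‖ = ‖q‖ * ‖z‖ := by
    conv_lhs => rw [eq_neg_of_add_eq_zero_left hz]
    rw [norm_neg, norm_mul, RCLike.norm_conj]
  have := norm_pos_iff.2 h
  nlinarith

/-- The area of the image of an annulus under an injective analytic function, followed by an affine
map, is at most the area of any disc that contains the image. -/
theorem integral_annulus_le {F F' : ℂ → ℂ} {ε r ρ : ℝ} {q : ℂ} (hq : ‖q‖ < 1) (hρ : 0 ≤ ρ)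
    (hF : ∀ w ∈ annulus ε r, HasDerivAt F (F' w) w) (hF' : ContinuousOn F' (annulus ε r))
    (hinj : Set.InjOn F (annulus ε r))
    (hle : ∀ w ∈ annulus ε r, ‖mulAddMulConj 1 q (F w)‖ ≤ ρ) :
    (1 - ‖q‖ ^ 2) * ∫ w in annulus ε r, ‖F' w‖ ^ 2 ≤ Real.pi * ρ ^ 2 := by
  have hms := (isCompact_annulus ε r).measurableSet
  have hder : ∀ w ∈ annulus ε r, HasFDerivWithinAt (fun w => mulAddMulConj 1 q (F w))
      ((mulAddMulConj 1 q).comp (mulAddMulConj (F' w) 0)) (annulus ε r) w := fun w hw => by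
    have h1 : HasFDerivAt F (mulAddMulConj (F' w) 0) w := by
      convert! (hF w hw).hasFDerivAt.restrictScalars ℝ using 1
      ext z
      simp [mulAddMulConj_apply, mul_comm]
    exact ((mulAddMulConj 1 q).hasFDerivAt.comp w h1).hasFDerivWithinAt
  have hq2 : 0 ≤ 1 - ‖q‖ ^ 2 := by nlinarith [norm_nonneg q]
  have hdet : ∀ w, |((mulAddMulConj 1 q).comp (mulAddMulConj (F' w) 0)).det| =
      (1 - ‖q‖ ^ 2) * ‖F' w‖ ^ 2 := fun w => by
    have h : ((mulAddMulConj 1 q).comp (mulAddMulConj (F' w) 0)).det =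
        (mulAddMulConj 1 q).det * (mulAddMulConj (F' w) 0).det := by
      simp [ContinuousLinearMap.det, LinearMap.det_comp]
    rw [h, det_mulAddMulConj, det_mulAddMulConj, norm_one, norm_zero, one_pow,
      zero_pow two_ne_zero, sub_zero, abs_of_nonneg (by positivity)]
  have harea := MeasureTheory.lintegral_abs_det_fderiv_eq_addHaar_image MeasureTheory.volume hms
    hder ((injective_mulAddMulConj hq).comp_injOn hinj)
  simp only [hdet] at harea
  have hci : MeasureTheory.IntegrableOn (fun w => (1 - ‖q‖ ^ 2) * ‖F' w‖ ^ 2) (annulus ε r) :=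
    (continuousOn_const.mul (hF'.norm.pow 2)).integrableOn_compact (isCompact_annulus ε r)
  rw [← MeasureTheory.ofReal_integral_eq_lintegral_ofReal hci
    (Eventually.of_forall fun w => by positivity), MeasureTheory.integral_const_mul] at harea
  have hsub : (fun w => mulAddMulConj 1 q (F w)) '' annulus ε r ⊆ Metric.closedBall 0 ρ := by
    rintro _ ⟨w, hw, rfl⟩
    simpa using hle w hw
  have hvol := MeasureTheory.measure_mono (μ := MeasureTheory.volume) hsub
  have hpi : (NNReal.pi : ENNReal) = ENNReal.ofReal Real.pi := by
    rw [← NNReal.coe_real_pi, ENNReal.ofReal_coe_nnreal]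
  rw [← harea, Complex.volume_closedBall, hpi, ← ENNReal.ofReal_pow hρ,
    ← ENNReal.ofReal_mul (by positivity), ENNReal.ofReal_le_ofReal_iff
      (by have := Real.pi_pos; positivity)] at hvol
  linarith

/-- The coefficient inequality `|b₁| ≤ 1` in the area theorem. -/
theorem norm_le_one_of_injOn {b : ℂ} {k : ℂ → ℂ} (hk : DifferentiableOn ℂ k unitDisc)
    (hinj : Set.InjOn (fun w => w⁻¹ + b * w + w ^ 2 * k w) (unitDisc \ {0})) : ‖b‖ ≤ 1 := by
  set F : ℂ → ℂ := fun w => w⁻¹ + b * w + w ^ 2 * k w with hF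
  set m : ℂ → ℂ := fun w => 2 * w * k w + w ^ 2 * deriv k w with hm
  have hmd : DifferentiableOn ℂ m unitDisc := by
    have := hk.deriv isOpen_unitDisc
    fun_prop
  have hFd : ∀ w ∈ unitDisc, w ≠ 0 → HasDerivAt F (-(w ^ 2)⁻¹ + b + m w) w := by
    intro w hw hw0
    have h1 := (hk.differentiableAt (isOpen_unitDisc.mem_nhds hw)).hasDerivAt
    convert! ((hasDerivAt_inv hw0).add ((hasDerivAt_id w).const_mul b)).add
      ((hasDerivAt_pow 2 w).mul h1) using 1
    simp [hm]
  -- The image of the annulus lies in a slightly deformed ellipse of size about `ε⁻¹`. Comparing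
  -- areas, the `ε⁻²` terms cancel, and letting `ε → 0` leaves `|b|² r² - r⁻² ≤ 0`.
  have key : ∀ r : ℝ, 0 < r → r < 1 → ‖b‖ ^ 2 * r ^ 2 ≤ (r ^ 2)⁻¹ := by
    intro r hr0 hr1
    obtain ⟨K, hK⟩ := (isCompact_closedBall (0 : ℂ) r).exists_bound_of_continuousOn
      (hk.continuousOn.mono fun w hw => mem_unitDisc.2 ((mem_closedBall_zero_iff.1 hw).trans_lt hr1))
    have hK0 : 0 ≤ K := (norm_nonneg _).trans (hK 0 (by simpa using hr0.le))
    set β := ‖b‖ with hβ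
    have hβ0 : 0 ≤ β := norm_nonneg b
    set L := K * (1 + β) with hL
    have hL0 : 0 ≤ L := by positivity
    have main : ∀ ε : ℝ, 0 < ε → ε ≤ r → 2 * (β + L) * ε ≤ 1 →
        (1 - β ^ 2 * ε ^ 4) * (-(r ^ 2)⁻¹ + β ^ 2 * (r ^ 2 - ε ^ 2)) - β ^ 2 * ε ^ 2
          - 2 * (β ^ 2 + L) * ε - (β ^ 2 + L) ^ 2 * ε ^ 4 ≤ 0 := by
      intro ε hε hεr hε1
      have hεlt : ε < 1 := hεr.trans_lt hr1
      -- This choice makes `z ↦ z + q * conj z` round off the ellipse: on `|w| = ε` one has `q /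
      -- conj w = -b w`, which cancels the term `b w` of `F`. The image then fits in a disc of
      -- radius `ε⁻¹ + O(ε²)`, and the square of this radius is `ε⁻² + O(ε)`.
      set q : ℂ := -b * (ε : ℂ) ^ 2 with hq
      have hqn : ‖q‖ = β * ε ^ 2 := by
        rw [hq, norm_mul, norm_neg, norm_pow, Complex.norm_real, Real.norm_of_nonneg hε.le]
      have hqlt : ‖q‖ < 1 := by
        rw [hqn]
        nlinarith [mul_nonneg hβ0 hε.le, mul_nonneg hL0 hε.le]
      have hann : ∀ w ∈ annulus ε r, w ∈ unitDisc ∧ w ≠ 0 := fun w hw =>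
        ⟨mem_unitDisc.2 (hw.2.trans_lt hr1), norm_pos_iff.1 (hε.trans_le hw.1)⟩
      have hbound : ∀ w ∈ annulus ε r,
          ‖mulAddMulConj 1 q (F w)‖ ≤ ε⁻¹ + (β ^ 2 + L) * ε ^ 2 := by
        intro w hw
        have hw0 := (hann w hw).2
        have ht0 : 0 < ‖w‖ := norm_pos_iff.2 hw0
        have hkw := hK w (mem_closedBall_zero_iff.2 hw.2)
        have hεt : ε ≤ ‖w‖ := hw.1
        have ht1 : ‖w‖ < 1 := mem_unitDisc.1 (hann w hw).1
        have hconj : ((starRingEnd ℂ) w)⁻¹ = w / (‖w‖ : ℂ) ^ 2 := by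
          rw [← Complex.mul_conj']
          have : (starRingEnd ℂ) w ≠ 0 := (map_ne_zero _).2 hw0
          field_simp
        have hexp : mulAddMulConj 1 q (F w) = w⁻¹ +
            b * (((‖w‖ ^ 2 - ε ^ 2) / ‖w‖ ^ 2 : ℝ) : ℂ) * w +
            q * ((starRingEnd ℂ) b * (starRingEnd ℂ) w) +
            (w ^ 2 * k w + q * (starRingEnd ℂ) (w ^ 2 * k w)) := by
          have : (‖w‖ : ℂ) ≠ 0 := by exact_mod_cast ht0.ne'
          rw [mulAddMulConj_apply]
          simp only [hF, map_add, map_mul, map_inv₀, hconj]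
          push_cast
          rw [hq]
          field_simp
          ring
        have hn : ‖mulAddMulConj 1 q (F w)‖ ≤ ‖w‖⁻¹ +
            β * ((‖w‖ ^ 2 - ε ^ 2) / ‖w‖ ^ 2) * ‖w‖ +
            (β * ε ^ 2) * (β * ‖w‖) + (‖w‖ ^ 2 * K + β * ε ^ 2 * (‖w‖ ^ 2 * K)) := by
          have hfrac : 0 ≤ (‖w‖ ^ 2 - ε ^ 2) / ‖w‖ ^ 2 :=
            div_nonneg (by nlinarith) (by positivity)
          have hh : ‖w ^ 2 * k w‖ ≤ ‖w‖ ^ 2 * K := by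
            rw [norm_mul, norm_pow]; gcongr
          rw [hexp]
          refine (norm_add_le _ _).trans (add_le_add ((norm_add_le _ _).trans
            (add_le_add ((norm_add_le _ _).trans (add_le_add ?_ ?_)) ?_))
            ((norm_add_le _ _).trans (add_le_add hh ?_)))
          · rw [norm_inv]
          · rw [norm_mul, norm_mul, Complex.norm_real, Real.norm_of_nonneg hfrac]
          · rw [norm_mul q, norm_mul ((starRingEnd ℂ) b), RCLike.norm_conj, RCLike.norm_conj, hqn]
          · rw [norm_mul, RCLike.norm_conj, hqn]; gcongr
        refine hn.trans ?_
        set t := ‖w‖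
        have h1 : β * ((t ^ 2 - ε ^ 2) / t ^ 2) * t = β * (t ^ 2 - ε ^ 2) / t := by field_simp
        have h2 : ε⁻¹ - t⁻¹ = (t - ε) / (ε * t) := by field_simp
        have h3 : (β * ε ^ 2) * (β * t) ≤ β ^ 2 * ε ^ 2 := by
          have : 0 ≤ β ^ 2 * ε ^ 2 := by positivity
          nlinarith
        have h4 : t ^ 2 * K + β * ε ^ 2 * (t ^ 2 * K) ≤ L * t ^ 2 := by
          have : 0 ≤ β * (t ^ 2 * K) := by positivity
          have hε2 : ε ^ 2 ≤ 1 := by nlinarith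
          rw [hL]
          nlinarith
        -- For `|w| > ε` the cancellation of `b w` is incomplete. The excess is absorbed by the gap
        -- `ε⁻¹ - |w|⁻¹`, thanks to the smallness condition `2 (β + L) ε ≤ 1`.
        have h5 : β * (t ^ 2 - ε ^ 2) / t + L * (t ^ 2 - ε ^ 2) ≤ (t - ε) / (ε * t) := by
          have h6 : (β + L * t) * (t + ε) * ε ≤ 1 := by
            calc (β + L * t) * (t + ε) * ε ≤ (β + L * 1) * (1 + 1) * ε := by gcongr
              _ ≤ 1 := by linarith
          rw [le_div_iff₀ (by positivity)]
          calc (β * (t ^ 2 - ε ^ 2) / t + L * (t ^ 2 - ε ^ 2)) * (ε * t)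
              = (t - ε) * ((β + L * t) * (t + ε) * ε) := by field_simp; ring
            _ ≤ (t - ε) * 1 := by
                gcongr
            _ = t - ε := mul_one _
        rw [h1]
        linarith
      have hup := integral_annulus_le (q := q) hqlt (ρ := ε⁻¹ + (β ^ 2 + L) * ε ^ 2)
        (by positivity) (fun w hw => hFd w (hann w hw).1 (hann w hw).2)
        (((((continuousOn_id.pow 2).inv₀ fun w hw => pow_ne_zero 2 (hann w hw).2).neg.add
          continuousOn_const).add (hmd.continuousOn.mono fun w hw => (hann w hw).1)))
        (hinj.mono fun w hw => hann w hw) hbound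
      have hlow := le_integral_annulus_normSq (b := b) hmd (by simp [hm]) hε hεr hr1
      have hq2 : 0 ≤ 1 - ‖q‖ ^ 2 := by nlinarith [norm_nonneg q]
      have hcomb := (mul_le_mul_of_nonneg_left hlow hq2).trans hup
      rw [hqn, ← hβ] at hcomb
      have hcomb' : (1 - (β * ε ^ 2) ^ 2) *
          ((ε ^ 2)⁻¹ - (r ^ 2)⁻¹ + β ^ 2 * (r ^ 2 - ε ^ 2)) ≤
          (ε⁻¹ + (β ^ 2 + L) * ε ^ 2) ^ 2 :=
        le_of_mul_le_mul_left (by linarith) Real.pi_pos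
      have e1 : (1 - (β * ε ^ 2) ^ 2) * (ε ^ 2)⁻¹ = (ε ^ 2)⁻¹ - β ^ 2 * ε ^ 2 := by
        field_simp
      have e2 : (ε⁻¹ + (β ^ 2 + L) * ε ^ 2) ^ 2 =
          (ε ^ 2)⁻¹ + 2 * (β ^ 2 + L) * ε + (β ^ 2 + L) ^ 2 * ε ^ 4 := by
        field_simp
        ring
      rw [e2] at hcomb'
      linarith
    have hcont : Continuous fun ε : ℝ =>
        (1 - β ^ 2 * ε ^ 4) * (-(r ^ 2)⁻¹ + β ^ 2 * (r ^ 2 - ε ^ 2)) - β ^ 2 * ε ^ 2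
          - 2 * (β ^ 2 + L) * ε - (β ^ 2 + L) ^ 2 * ε ^ 4 := by fun_prop
    have hlim := (hcont.tendsto 0).mono_left (nhdsWithin_le_nhds (s := Set.Ioi 0))
    have hfin := le_of_tendsto hlim (b := 0) (by
      have h1 : ∀ᶠ ε : ℝ in 𝓝[>] 0, 2 * (β + L) * ε < 1 := by
        have : Tendsto (fun ε : ℝ => 2 * (β + L) * ε) (𝓝[>] 0) (𝓝 (2 * (β + L) * 0)) :=
          (by fun_prop : Continuous fun ε : ℝ => 2 * (β + L) * ε).tendsto 0 |>.mono_left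
            nhdsWithin_le_nhds
        rw [mul_zero] at this
        exact this.eventually_lt_const one_pos
      filter_upwards [Ioc_mem_nhdsGT hr0, h1] with ε hε h1 using main ε hε.1 hε.2 h1.le)
    simp at hfin
    linarith
  have h1 : Tendsto (fun r : ℝ => ‖b‖ ^ 2 * r ^ 2) (𝓝[<] 1) (𝓝 (‖b‖ ^ 2 * 1 ^ 2)) :=
    ((by fun_prop : Continuous fun r : ℝ => ‖b‖ ^ 2 * r ^ 2).tendsto 1).mono_left nhdsWithin_le_nhds
  have h2 : Tendsto (fun r : ℝ => (r ^ 2)⁻¹) (𝓝[<] 1) (𝓝 ((1 ^ 2)⁻¹)) :=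
    (((continuous_pow 2).tendsto (1 : ℝ)).inv₀ (by norm_num)).mono_left nhdsWithin_le_nhds
  have h3 := le_of_tendsto_of_tendsto h1 h2 (by
    filter_upwards [Ioo_mem_nhdsLT (zero_lt_one' ℝ)] with r hr using key r hr.1 hr.2)
  have h4 : ‖b‖ ^ 2 ≤ 1 := by simpa using h3
  nlinarith [norm_nonneg b]

/-! ### Taylor remainders and Kraus' theorem. -/

theorem exists_taylor_one {f : ℂ → ℂ} (hf : DifferentiableOn ℂ f unitDisc) :
    ∃ k : ℂ → ℂ, DifferentiableOn ℂ k unitDisc ∧ (∀ w, f w = f 0 + w * k w) ∧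
      (∀ w ∈ unitDisc, deriv f w = k w + w * deriv k w) ∧ k 0 = deriv f 0 ∧
      deriv (deriv f) 0 = 2 * deriv k 0 := by
  have hk : DifferentiableOn ℂ (dslope f 0) unitDisc :=
    (Complex.differentiableOn_dslope (isOpen_unitDisc.mem_nhds zero_mem_unitDisc)).2 hf
  have hfk : ∀ w, f w = f 0 + w * dslope f 0 w := fun w => by
    have := sub_smul_dslope f 0 w
    rw [sub_zero, smul_eq_mul] at this
    rw [this]; ring
  have hd : ∀ w ∈ unitDisc, deriv f w = dslope f 0 w + w * deriv (dslope f 0) w := fun w hw => by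
    have h1 := (hk.differentiableAt (isOpen_unitDisc.mem_nhds hw)).hasDerivAt
    have h2 := ((hasDerivAt_id w).mul h1).const_add (f 0)
    rw [show f = fun w => f 0 + w * dslope f 0 w from funext hfk]
    convert! h2.deriv using 1
    rw [← show f = fun w => f 0 + w * dslope f 0 w from funext hfk]
    simp
  refine ⟨dslope f 0, hk, hfk, hd, dslope_same f 0, ?_⟩
  have h1 : deriv f =ᶠ[𝓝 0] fun w => dslope f 0 w + w * deriv (dslope f 0) w := by
    filter_upwards [isOpen_unitDisc.mem_nhds zero_mem_unitDisc] with w hw using hd w hw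
  have h2 := (hk.differentiableAt (isOpen_unitDisc.mem_nhds zero_mem_unitDisc)).hasDerivAt
  have h3 := ((hk.deriv isOpen_unitDisc).differentiableAt
    (isOpen_unitDisc.mem_nhds zero_mem_unitDisc)).hasDerivAt
  rw [h1.deriv_eq]
  convert! (h2.add ((hasDerivAt_id (0 : ℂ)).mul h3)).deriv using 1
  simp
  ring

theorem exists_taylor_two {f : ℂ → ℂ} (hf : DifferentiableOn ℂ f unitDisc) :
    ∃ k : ℂ → ℂ, DifferentiableOn ℂ k unitDisc ∧
      ∀ w, f w = f 0 + deriv f 0 * w + deriv (deriv f) 0 / 2 * w ^ 2 + w ^ 3 * k w := by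
  obtain ⟨k₁, hk₁, h₁, -, h₁0, h₁d⟩ := exists_taylor_one hf
  obtain ⟨k₂, hk₂, h₂, -, h₂0, -⟩ := exists_taylor_one hk₁
  obtain ⟨k₃, hk₃, h₃, -, -, -⟩ := exists_taylor_one hk₂
  refine ⟨k₃, hk₃, fun w => ?_⟩
  rw [h₁ w, h₂ w, h₃ w, h₂0, h₁0, h₁d]
  ring

/-- Kraus' theorem at the origin, in terms of zeros of solutions. -/
theorem norm_le_three_of_kraus {B g₁ g₂ : ℂ → ℂ} (hB : DifferentiableAt ℂ B 0)
    (hg₁ : IsSolution B g₁) (hg₂ : IsSolution B g₂) (h₁0 : g₁ 0 = 0) (h₁d : deriv g₁ 0 = 1)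
    (h₂0 : g₂ 0 = 1) (h₂d : deriv g₂ 0 = 0) (hz₁ : ∀ w ∈ unitDisc, g₁ w = 0 → w = 0)
    (hz : ∀ c : ℂ, ∀ w ∈ unitDisc, ∀ w' ∈ unitDisc,
      g₂ w + c * g₁ w = 0 → g₂ w' + c * g₁ w' = 0 → w = w') : ‖B 0‖ ≤ 3 := by
  obtain ⟨h, hh, hgh, hd, hh0, hdd⟩ := exists_taylor_one hg₁.differentiableOn
  have hn := isOpen_unitDisc.mem_nhds zero_mem_unitDisc
  rw [h₁d] at hh0
  have hg₁'' : deriv (deriv g₁) 0 = 0 := by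
    have := hg₁.equation 0 zero_mem_unitDisc
    rwa [h₁0, mul_zero, add_zero] at this
  have hh1 : deriv h 0 = 0 := by
    rw [hg₁''] at hdd
    simpa using hdd.symm
  have hh' := (hh.deriv isOpen_unitDisc)
  have hh'' := (hh'.deriv isOpen_unitDisc)
  have hh2 : deriv (deriv h) 0 = -B 0 / 3 := by
    -- Substituting `g₁ = w * h` in the equation gives `2 h' + w h'' = -B w h`; differentiating once
    -- more at `0` gives `3 h''(0) = -B 0`.
    have h1 : ∀ w ∈ unitDisc, 2 * deriv h w + w * deriv (deriv h) w = -(B w * (w * h w)) := by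
      intro w hw
      have h2 : deriv g₁ =ᶠ[𝓝 w] fun w => h w + w * deriv h w := by
        filter_upwards [isOpen_unitDisc.mem_nhds hw] with v hv using hd v hv
      have h3 := (hh.differentiableAt (isOpen_unitDisc.mem_nhds hw)).hasDerivAt
      have h4 := (hh'.differentiableAt (isOpen_unitDisc.mem_nhds hw)).hasDerivAt
      have h5 := (hg₁.hasDerivAt_deriv hw).deriv
      have h6 := (h3.add ((hasDerivAt_id w).mul h4)).deriv
      rw [h2.deriv_eq] at h5
      rw [hgh w, h₁0, zero_add] at h5
      rw [← h5]
      refine Eq.trans ?_ h6.symm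
      simp only [id]
      ring
    have h2 : (fun w => 2 * deriv h w + w * deriv (deriv h) w) =ᶠ[𝓝 0]
        fun w => -(B w * (w * h w)) := by
      filter_upwards [hn] with w hw using h1 w hw
    have h3 := (hh.differentiableAt hn).hasDerivAt
    have h4 := (hh'.differentiableAt hn).hasDerivAt
    have h5 := (hh''.differentiableAt hn).hasDerivAt
    have h6 : HasDerivAt (fun w => 2 * deriv h w + w * deriv (deriv h) w)
        (3 * deriv (deriv h) 0) 0 := by
      convert! (h4.const_mul 2).add ((hasDerivAt_id (0 : ℂ)).mul h5) using 1
      simp only [id]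
      ring
    have h7 : HasDerivAt (fun w => -(B w * (w * h w))) (-B 0) 0 := by
      convert! (hB.hasDerivAt.mul ((hasDerivAt_id (0 : ℂ)).mul h3)).neg using 1
      simp [hh0]
    have h8 := h2.deriv_eq
    rw [h6.deriv, h7.deriv] at h8
    rw [← h8]; ring
  have hg₂'' : deriv (deriv g₂) 0 = -B 0 := by
    have := hg₂.equation 0 zero_mem_unitDisc
    rw [h₂0, mul_one] at this
    exact eq_neg_of_add_eq_zero_left this
  obtain ⟨k₁, hk₁, hhk⟩ := exists_taylor_two hh
  obtain ⟨k₂, hk₂, hgk⟩ := exists_taylor_two hg₂.differentiableOn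
  simp only [hh0, hh1, hh2] at hhk
  simp only [h₂0, h₂d, hg₂''] at hgk
  have hhne : ∀ w ∈ unitDisc, h w ≠ 0 := by
    intro w hw h0
    have h1 := hgh w
    rw [h₁0, zero_add, h0, mul_zero] at h1
    rw [hz₁ w hw h1, hh0] at h0
    exact one_ne_zero h0
  -- `n` is `g₂ - (1 - (B 0 / 3) w²) h` divided by `w³`. Dividing by `g₁ = w h` then shows that `g₂
  -- / g₁` is `w⁻¹ - (B 0 / 3) w` plus `w²` times the analytic function `n / h`.
  set n : ℂ → ℂ := fun w => k₂ w - k₁ w + B 0 / 3 * w ^ 2 * k₁ w - (B 0) ^ 2 / 18 * w with hndef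
  have hquot : ∀ w ∈ unitDisc, w ≠ 0 →
      w⁻¹ + (-B 0 / 3) * w + w ^ 2 * (n w / h w) = g₂ w / g₁ w := by
    intro w hw hw0
    have h1 := hhne w hw
    have h2 : n w * w ^ 3 = g₂ w - (1 - B 0 / 3 * w ^ 2) * h w := by
      rw [hgk w, hhk w]; simp only [hndef]; ring
    rw [hgh w, h₁0, zero_add]
    field_simp
    linear_combination 3 * h2
  have hb := norm_le_one_of_injOn (b := -B 0 / 3) (k := fun w => n w / h w)
    (DifferentiableOn.div (by fun_prop) hh hhne) (by
      intro w hw w' hw' heq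
      have hw0 : w ≠ 0 := hw.2
      have hw0' : w' ≠ 0 := hw'.2
      simp only at heq
      rw [hquot w hw.1 hw0, hquot w' hw'.1 hw0'] at heq
      have e1 : g₁ w ≠ 0 := fun h => hw0 (hz₁ w hw.1 h)
      have e2 : g₁ w' ≠ 0 := fun h => hw0' (hz₁ w' hw'.1 h)
      -- Two points where `g₂ / g₁` takes the same value `κ` are both zeros of the solution `g₂ - κ
      -- g₁`.
      refine hz (-(g₂ w / g₁ w)) w hw.1 w' hw'.1 ?_ ?_
      · field_simp; ring
      · rw [heq]; field_simp; ring)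
  rw [norm_div, norm_neg] at hb
  have h3 : ‖(3 : ℂ)‖ = 3 := by norm_num
  rw [h3] at hb
  linarith

/-! ### From separated zeros to the growth bound: part (ii). -/

/-- Kraus' theorem in the discs of radius `ρ = (1 + C)⁻¹`, rescaled. -/
theorem AtMostOneZeroInDiscs.norm_mul_le {A : ℂ → ℂ} {C : ℝ} (hC : 0 < C)
    (hA : DifferentiableOn ℂ A unitDisc) (h : AtMostOneZeroInDiscs A C) {z : ℂ}
    (hz : C / (1 + C) < ‖z‖) (hz1 : ‖z‖ < 1) :
    ‖A z‖ * ((1 - ‖z‖) * (2 - (1 + C) * (1 - ‖z‖))) ^ 2 ≤ 3 := by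
  set r := ‖z‖ with hr
  set ρ : ℝ := (1 + C)⁻¹ with hρ
  have hρ0 : 0 < ρ := by positivity
  have hρC : (1 + C) * ρ = 1 := mul_inv_cancel₀ (by positivity)
  have hCρ : C / (1 + C) = 1 - ρ := by
    rw [div_eq_mul_inv, ← hρ]; linarith
  have hρ1 : 0 < 1 - ρ := by rw [← hCρ]; positivity
  rw [hCρ] at hz
  have hr0 : 0 < r := hρ1.trans hz
  have hrc : (r : ℂ) ≠ 0 := by exact_mod_cast hr0.ne'
  have hρc : (ρ : ℂ) ≠ 0 := by exact_mod_cast hρ0.ne'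
  set u : ℂ := z / r with hu
  have hur : u * r = z := by rw [hu]; field_simp
  have hu1 : ‖u‖ = 1 := by
    rw [hu, norm_div, Complex.norm_real, Real.norm_of_nonneg hr0.le, div_self hr0.ne']
  -- The disc of radius `ρ` about `ζ` is internally tangent to the unit circle at `u = z / |z|`. In
  -- its normalised coordinate `z` becomes `a = s u`.
  set ζ : ℂ := ((1 - ρ : ℝ) : ℂ) * u with hζ
  have hζn : ‖ζ‖ = 1 - ρ := by
    rw [hζ, norm_mul, hu1, mul_one, Complex.norm_real, Real.norm_of_nonneg hρ1.le]
  set s : ℝ := (r - (1 - ρ)) / ρ with hs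
  have hρs : ρ * s = r - (1 - ρ) := by rw [hs]; field_simp
  have hs0 : 0 < s := div_pos (by linarith) hρ0
  have hs1 : s < 1 := by rw [hs, div_lt_one hρ0]; linarith
  set a : ℂ := (s : ℂ) * u with ha
  have han : ‖a‖ = s := by
    rw [ha, norm_mul, hu1, mul_one, Complex.norm_real, Real.norm_of_nonneg hs0.le]
  have had : a ∈ unitDisc := mem_unitDisc.2 (han ▸ hs1)
  have hza : ζ + ρ * a = z := by
    have : (ρ : ℂ) * s = r - (1 - ρ) := by exact_mod_cast hρs
    rw [hζ, ha, ← hur]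
    push_cast
    linear_combination u * this
  set a' := (starRingEnd ℂ) a with ha'
  have hne : ∀ w ∈ unitDisc, a' * w + 1 ≠ 0 := fun w hw => by
    rw [add_comm]; exact one_add_conj_mul_ne_zero had hw
  have hMeq : ∀ w ∈ unitDisc, ((ρ + ζ * a') * w + z) / (a' * w + 1) =
      ζ + ρ * ((w + a) / (1 + a' * w)) := fun w hw => by
    have := hne w hw
    rw [add_comm 1 (a' * w), ← hza]
    obtain ⟨E, hE⟩ : ∃ E, E = a' * w + 1 := ⟨_, rfl⟩
    rw [← hE] at this ⊢
    field_simp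
    rw [hE]; ring
  have hball : ∀ w ∈ unitDisc, ((ρ + ζ * a') * w + z) / (a' * w + 1) ∈ Metric.ball ζ ρ :=
    fun w hw => by
      have h1 := mem_unitDisc.1 (mobius_mem_unitDisc had hw)
      rw [hMeq w hw, mem_ball_iff_norm, add_sub_cancel_left, norm_mul, Complex.norm_real,
        Real.norm_of_nonneg hρ0.le]
      nlinarith
  have hmaps : ∀ w ∈ unitDisc, ((ρ + ζ * a') * w + z) / (a' * w + 1) ∈ unitDisc := fun w hw => by
    have h1 := mem_ball_iff_norm.1 (hball w hw)
    rw [mem_unitDisc]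
    have h2 := norm_add_le (((ρ + ζ * a') * w + z) / (a' * w + 1) - ζ) ζ
    rw [sub_add_cancel] at h2
    linarith
  have hzd : z ∈ unitDisc := mem_unitDisc.2 hz1
  -- `D` is the determinant of the Möbius map and also its derivative at `0`, namely `ρ (1 - s²)`.
  set D : ℂ := (ρ + ζ * a') * 1 - z * a' with hD
  have hDval : D = ((ρ * (1 - s ^ 2) : ℝ) : ℂ) := by
    have : a * a' = (s : ℂ) ^ 2 := by rw [ha', Complex.mul_conj', han]
    rw [hD, ← hza]
    push_cast
    linear_combination (-(ρ : ℂ)) * this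
  have hDpos : 0 < ρ * (1 - s ^ 2) := mul_pos hρ0 (by nlinarith)
  have hD0 : D ≠ 0 := by rw [hDval]; exact_mod_cast hDpos.ne'
  have hMinj : ∀ w ∈ unitDisc, ∀ w' ∈ unitDisc, ((ρ + ζ * a') * w + z) / (a' * w + 1) =
      ((ρ + ζ * a') * w' + z) / (a' * w' + 1) → w = w' := by
    intro w hw w' hw' heq
    rw [div_eq_div_iff (hne w hw) (hne w' hw')] at heq
    have h1 : D * (w - w') = 0 := by rw [hD]; linear_combination heq
    exact sub_eq_zero.1 ((mul_eq_zero.1 h1).resolve_left hD0)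
  -- The data at `z` are chosen so that the pull-backs have value and derivative `(0, 1)` and `(1,
  -- 0)` at the origin; the derivative there is `a' * f z + D * f' z`.
  obtain ⟨f₁, hf₁, hf₁0, hf₁d⟩ := exists_isSolution hA hzd 0 (1 / D)
  obtain ⟨f₂, hf₂, hf₂0, hf₂d⟩ := exists_isSolution hA hzd 1 (-a' / D)
  obtain ⟨hg₁, hg₁'⟩ := hf₁.mobius hne hmaps
  obtain ⟨hg₂, hg₂'⟩ := hf₂.mobius hne hmaps
  have hM0 : ((ρ + ζ * a') * 0 + z) / (a' * 0 + 1) = z := by simp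
  have hkraus := norm_le_three_of_kraus ?_ hg₁ hg₂ ?_ ?_ ?_ ?_ ?_ ?_
  · rw [hM0, ← hD, mul_zero, zero_add, one_pow, div_one, hDval, norm_mul, norm_pow,
      Complex.norm_real, Real.norm_of_nonneg hDpos.le] at hkraus
    have e : (1 - r) * (2 - (1 + C) * (1 - r)) = ρ * (1 - s ^ 2) := by
      have e1 : 1 - r = ρ * (1 - s) := by linear_combination hρs
      rw [e1]
      linear_combination (-ρ * (1 - s) ^ 2) * hρC
    rw [e]
    exact hkraus
  · have hM : DifferentiableAt ℂ (fun w => ((ρ + ζ * a') * w + z) / (a' * w + 1)) 0 :=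
      DifferentiableAt.fun_div (by fun_prop) (by fun_prop) (hne 0 zero_mem_unitDisc)
    have hA' : DifferentiableAt ℂ A (((ρ + ζ * a') * 0 + z) / (a' * 0 + 1)) := by
      rw [hM0]; exact hA.differentiableAt (isOpen_unitDisc.mem_nhds hzd)
    have hM' : DifferentiableAt ℂ
        (fun w => ((ρ + ζ * a') * 1 - z * a') / (a' * w + 1) ^ 2) 0 :=
      DifferentiableAt.fun_div (by fun_prop) (by fun_prop)
        (pow_ne_zero 2 (hne 0 zero_mem_unitDisc))
    exact (DifferentiableAt.comp (0 : ℂ) hA' hM).fun_mul (hM'.fun_pow 2)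
  · rw [hM0, hf₁0, mul_zero]
  · rw [(hg₁' 0 zero_mem_unitDisc).deriv, hM0, hf₁0, hf₁d, ← hD]
    simp [hD0]
  · rw [hM0, hf₂0]; simp
  · rw [(hg₂' 0 zero_mem_unitDisc).deriv, hM0, hf₂0, hf₂d, ← hD]
    simp [hD0]
  · intro w hw hgw
    have h1 := (mul_eq_zero.1 hgw).resolve_left (hne w hw)
    have hnt : ∃ v ∈ unitDisc, f₁ v ≠ 0 := by
      by_contra! hcon
      have h2 : f₁ =ᶠ[𝓝 z] fun _ => 0 := by
        filter_upwards [isOpen_unitDisc.mem_nhds hzd] with v hv using hcon v hv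
      rw [h2.deriv_eq, deriv_const] at hf₁d
      exact one_div_ne_zero hD0 hf₁d.symm
    obtain ⟨v, hv, hfv⟩ := hnt
    refine hMinj w hw 0 zero_mem_unitDisc (h f₁ (hf₁.isNontrivialSolution hv hfv) ζ
      (by rw [hCρ, hζn]) ⟨hball w hw, h1⟩ ⟨hball 0 zero_mem_unitDisc, ?_⟩)
    rw [hM0, hf₁0]
  · intro c w hw w' hw' h1 h2
    have hfc := hf₂.add_const_mul hf₁ c
    have hfcz : f₂ z + c * f₁ z ≠ 0 := by rw [hf₂0, hf₁0]; simp
    refine hMinj w hw w' hw' (h _ (hfc.isNontrivialSolution hzd hfcz) ζ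
      (by rw [hCρ, hζn]) ⟨hball w hw, ?_⟩ ⟨hball w' hw', ?_⟩)
    · refine (mul_eq_zero.1 ?_).resolve_left (hne w hw)
      linear_combination h1
    · refine (mul_eq_zero.1 ?_).resolve_left (hne w' hw')
      linear_combination h2

theorem mainTheorem3 (C : ℝ) (hC : 0 < C) :
    (∀ A : ℂ → ℂ, AnalyticOnNhd ℂ A unitDisc →
      (∀ z ∈ unitDisc, ‖A z‖ * (1 - ‖z‖ ^ 2) ^ 2 ≤ 1 + C * (1 - ‖z‖)) →
        AtMostOneZeroInDiscs A C) ∧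
    (∃ Ψ : ℝ → ℝ,
      (∀ r : ℝ, C / (1 + C) < r → r < 1 → 0 < Ψ r) ∧
      Tendsto Ψ (𝓝[<] 1) (𝓝[>] (2 * C)) ∧
      ∀ A : ℂ → ℂ, AnalyticOnNhd ℂ A unitDisc → AtMostOneZeroInDiscs A C →
        ∀ z : ℂ, C / (1 + C) < ‖z‖ → ‖z‖ < 1 →
          ‖A z‖ * (1 - ‖z‖ ^ 2) ^ 2 ≤ 3 * (1 + Ψ ‖z‖ * (1 - ‖z‖))) := by
  refine ⟨fun A _ hA => atMostOneZeroInDiscs_of_norm_le hC hA,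
    -- With `x = 1 - r`, the first entry `ψ` solves `1 + ψ x = (2 - x)² / (2 - (1 + C) x)²`, exactly
    -- the factor lost in passing from the Kraus bound to `(1 - |z|²)²`. It tends to `C`; the second
    -- entry dominates near `1` and gives the limit `2 C` from above, as well as positivity.
    fun r => max (C * (4 - (2 + C) * (1 - r)) / (2 - (1 + C) * (1 - r)) ^ 2) (2 * C + (1 - r)),
    fun r _ hr => lt_max_of_lt_right (by linarith), ?_, ?_⟩
  · refine tendsto_nhdsWithin_iff.2 ⟨?_, ?_⟩
    · have hcont : ContinuousAt (fun r : ℝ => max (C * (4 - (2 + C) * (1 - r)) /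
          (2 - (1 + C) * (1 - r)) ^ 2) (2 * C + (1 - r))) 1 :=
        (ContinuousAt.div (by fun_prop) (by fun_prop) (by norm_num)).max
          (by fun_prop : ContinuousAt (fun r : ℝ => 2 * C + (1 - r)) 1)
      have h := hcont.tendsto.mono_left (nhdsWithin_le_nhds (s := Set.Iio 1))
      have hval : max (C * (4 - (2 + C) * (1 - 1)) / (2 - (1 + C) * (1 - 1)) ^ 2)
          (2 * C + (1 - 1)) = 2 * C := by
        rw [max_eq_right]
        · ring
        · ring_nf; linarith
      rwa [hval] at h
    · filter_upwards [self_mem_nhdsWithin] with r hr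
      refine Set.mem_Ioi.2 (lt_max_of_lt_right ?_)
      linarith [Set.mem_Iio.1 hr]
  · intro A hA h z hz hz1
    have hk := h.norm_mul_le hC hA.differentiableOn hz hz1
    set x := 1 - ‖z‖ with hx
    have hx0 : 0 < x := by linarith
    have hx1 : (1 + C) * x < 1 := by
      rw [div_lt_iff₀ (by positivity)] at hz
      linarith
    set q := 2 - (1 + C) * x with hq
    have hq0 : 0 < q := by linarith
    have hsq : (1 - ‖z‖ ^ 2) ^ 2 = x ^ 2 * (2 - x) ^ 2 := by rw [hx]; ring
    have hid : 1 + C * (4 - (2 + C) * x) / q ^ 2 * x = (2 - x) ^ 2 / q ^ 2 := by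
      field_simp
      rw [hq]; ring
    calc ‖A z‖ * (1 - ‖z‖ ^ 2) ^ 2 = ‖A z‖ * (x * q) ^ 2 * ((2 - x) ^ 2 / q ^ 2) := by
          rw [hsq]; field_simp
      _ ≤ 3 * ((2 - x) ^ 2 / q ^ 2) := by gcongr
      _ = 3 * (1 + C * (4 - (2 + C) * x) / q ^ 2 * x) := by rw [hid]
      _ ≤ _ := by
          gcongr
          exact le_max_left _ _
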